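/- **Setting.** Let $V$ and $H$ be real Hilbert spaces, $V$ densely and continuously embedded in $H$, so that $V\subset H=H'\subset V'$. Write $(\cdot,\cdot)$, $|\cdot|$ for the inner product and norm of $H$ (and $(\cdot,\cdot)$ also for the duality of $V'$ and $V$). Let $\mathcal L:V\to V'$ be linear, self-adjoint and positive definite, let $V$ be normed by $\|v\|=(\mathcal Lv,v)^{1/2}$, and let $\|\cdot\|_\star$ be the dual norm on $V'$. Let $\mathcal G:V\to V'$, $f$ with values in $V'$, $0<T<T'$, and let $u:[0,T']\to V$ be a solution of $$u_t+\mathcal Lu+\mathcal G(u)=f\quad\text{in } V',\qquad 0<t<T',$$ which is continuous into $V$ and differentiable into $H$ on $(0,T')$. (The scheme on $[0,T]$ with step $\Delta t$ uses data, and the statement uses $u$, at times slightly beyond $T$, hence $T'>T$.) For $w\in V$ put $\mathcal B_w=\{v\in V:\|v-w\|\le1\}$. Assume that for some $\gamma\ge0$, $\mu\in\mathbb R$, $$\|\mathcal G(v)-\mathcal G(\tilde v)\|_\star^2\le\gamma\|v-\tilde v\|^2+\mu|v-\tilde v|^2\qquad\forall\,v,\tilde v\in\mathcal B_{u(t)},\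 \forall\,t\in[0,T].$$ **Scheme.** Let $k\in\{2,3,4\}$ and $\beta\ge 1$. Let $a_{k,q}$ $(0\le q\le k)$ and $b_{k,q},c_{k,q}$ $(0\le q\le k-1)$ be the unique solutions of $$\sum_{q=0}^{k}a_{k,q}(\beta-1+k-q)^m=-\delta_{m,1}\ (0\le m\le k),$$ $$\sum_{q=0}^{k-1}b_{k,q}(\beta+k-2-q)^m=\delta_{m,0},\qquad \sum_{q=0}^{k-1}c_{k,q}(\beta+k-1-q)^m=\delta_{m,0}\quad(0\le m\le k-1),$$ where $0^0=1$. For a sequence $(x^i)$ put $A_k^\beta(x^i)=\sum_{q=0}^{k}a_{k,q}x^{i-k+q}$, $B_k^\beta(x^i)=\sum_{q=0}^{k-1}b_{k,q}x^{i-k+1+q}$, $C_k^\beta(x^i)=\sum_{q=0}^{k-1}c_{k,q}x^{i-k+1+q}$. Let $$\eta_2(\beta)=\frac{\beta-1}{\beta},\qquad \eta_3(\beta)=\frac{\beta-1}{\beta+1},\qquad \eta_4(\beta)=\frac{\beta-1}{\beta+3}.$$ With $t^s=s\Delta t$, the IMEX scheme is $$\frac1{\Delta t}A_k^\beta(\phi^{n+1})+\mathcal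 LB_k^\beta(\phi^{n+1})+\mathcal G\big(C_k^\beta(\phi^n)\big)=f(t^{n+\beta})\ \text{ in } V',\qquad n\ge k-1,\ t^{n+1}\le T.$$ **Truncation errors.** Put $E_k^{n+1}=\Delta t\,u_t(t^{n+\beta})-A_k^\beta(u(t^{n+1}))$, $R_k^{n+1}=u(t^{n+\beta})-B_k^\beta(u(t^{n+1}))$, $P_k^n=u(t^{n+\beta})-C_k^\beta(u(t^n))$, where $C_k^\beta(u(t^n))$ is $C_k^\beta(x^n)$ for $x^i=u(t^i)$, and so on. Say that (TE) holds if there is a constant $K$ such that for all sufficiently small $\Delta t>0$ and all $n\ge k-1$ with $t^{n+1}\le T$ $$|E_k^{n+1}|^2\le K\Delta t^{2k+2},\qquad\|R_k^{n+1}\|^2\le K\Delta t^{2k},\qquad\|P_k^n\|^2\le K\Delta t^{2k}.$$ **Theorem.** There are constants $g_k>0$ depending only on $k$ such that the following holds. Let $\beta>1$ if $k=2,3$ and $\beta\ge2$ if $k=4$, and suppose that $\eta_k(\beta)-\sqrt\gamma\ge\rho>0$. (a) If $u\in C^k([0,T'];V)\cap C^{k+1}([0,T'];H)$, then (TE) holds.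 (b) Suppose that (TE) holds, and let $C_0$ be a constant. Then there are $C>0$ and $\tau>0$ with $C\tau<1$ such that for every $0<\Delta t\le\tau$ and every sequence $(\phi^n)$ in $V$ which satisfies the scheme, $\phi^0=u(0)$, $$|\phi^i-u(t^i)|^2\le C_0\Delta t^{2k},\quad\|\phi^i-u(t^i)\|^2\le C_0\Delta t^{2k}\quad(1\le i\le k-1),\qquad C_k^\beta(\phi^{k-1})\in\mathcal B_{u(t^{k-1+\beta})},$$ we have, with $e^m=\phi^m-u(t^m)$, for all $n\ge 0$ with $t^{n+1}\le T$, $$C_k^\beta(\phi^{n+1})\in\mathcal B_{u(t^{n+1+\beta})}\quad(\text{if } n+1\ge k-1),$$ $$g_k|e^{n+1}|^2+\frac\rho2\Delta t\sum_{q=k-1}^{n+1}\|C_k^\beta(e^q)\|^2\le C\exp\big((1-C\Delta t)^{-1}T\big)\Delta t^{2k}.$$ -/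

import Mathlib

namespace IMEX

/-! Coefficients of the schemes of order `k = 2, 3, 4` (and `0` for every other index). -/

/-- The coefficients `a_{k,q}(β)`. -/
noncomputable def coeffA : ℕ → ℕ → ℝ → ℝ
  | 2, 0, β => (2 * β - 1) / 2
  | 2, 1, β => -2 * β
  | 2, 2, β => (2 * β + 1) / 2
  | 3, 0, β => -(3 * β ^ 2 - 1) / 6
  | 3, 1, β => (9 * β ^ 2 + 6 * β - 6) / 6
  | 3, 2, β => -(9 * β ^ 2 + 12 * β - 3) / 6
  | 3, 3, β => (3 * β ^ 2 + 6 * β + 2) / 6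
  | 4, 0, β => (2 * β ^ 3 + 3 * β ^ 2 - β - 1) / 12
  | 4, 1, β => (-8 * β ^ 3 - 18 * β ^ 2 + 4 * β + 6) / 12
  | 4, 2, β => (12 * β ^ 3 + 36 * β ^ 2 + 6 * β - 18) / 12
  | 4, 3, β => (-8 * β ^ 3 - 30 * β ^ 2 - 20 * β + 10) / 12
  | 4, 4, β => (2 * β ^ 3 + 9 * β ^ 2 + 11 * β + 3) / 12
  | _, _, _ => 0

/-- The coefficients `b_{k,q}(β)`. -/
noncomputable def coeffB : ℕ → ℕ → ℝ → ℝ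
  | 2, 0, β => -(β - 1)
  | 2, 1, β => β
  | 3, 0, β => (β ^ 2 - β) / 2
  | 3, 1, β => -(β ^ 2 - 1)
  | 3, 2, β => (β ^ 2 + β) / 2
  | 4, 0, β => (-β ^ 3 + β) / 6
  | 4, 1, β => (β ^ 3 + β ^ 2 - 2 * β) / 2
  | 4, 2, β => (-β ^ 3 - 2 * β ^ 2 + β + 2) / 2
  | 4, 3, β => (β ^ 3 + 3 * β ^ 2 + 2 * β) / 6
  | _, _, _ => 0

/-- The coefficients `c_{k,q}(β)`. -/
noncomputable def coeffC : ℕ → ℕ → ℝ → ℝ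
  | 2, 0, β => -β
  | 2, 1, β => β + 1
  | 3, 0, β => (β ^ 2 + β) / 2
  | 3, 1, β => -(β ^ 2 + 2 * β)
  | 3, 2, β => (β ^ 2 + 3 * β + 2) / 2
  | 4, 0, β => (-β ^ 3 - 3 * β ^ 2 - 2 * β) / 6
  | 4, 1, β => (β ^ 3 + 4 * β ^ 2 + 3 * β) / 2
  | 4, 2, β => (-β ^ 3 - 5 * β ^ 2 - 6 * β) / 2
  | 4, 3, β => (β ^ 3 + 6 * β ^ 2 + 11 * β + 6) / 6
  | _, _, _ => 0

/-- The coefficients `a_{k,q}(β)` solve the Vandermonde system that defines them. -/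
theorem coeffA_vandermonde (k : ℕ) (hk : k = 2 ∨ k = 3 ∨ k = 4) (β : ℝ) (m : ℕ) (hm : m ≤ k) :
    ∑ q ∈ Finset.range (k + 1), coeffA k q β * (β - 1 + ((k - q : ℕ) : ℝ)) ^ m
      = if m = 1 then -1 else 0 := by
  rcases hk with rfl | rfl | rfl <;> interval_cases m <;>
    norm_num [Finset.sum_range_succ, coeffA] <;> ring

/-- The coefficients `b_{k,q}(β)` solve the Vandermonde system that defines them. -/
theorem coeffB_vandermonde (k : ℕ) (hk : k = 2 ∨ k = 3 ∨ k = 4) (β : ℝ) (m : ℕ) (hm : m < k) :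
    ∑ q ∈ Finset.range k, coeffB k q β * (β - 1 + ((k - 1 - q : ℕ) : ℝ)) ^ m
      = if m = 0 then 1 else 0 := by
  rcases hk with rfl | rfl | rfl <;> interval_cases m <;>
    norm_num [Finset.sum_range_succ, coeffB] <;> ring

/-- The coefficients `c_{k,q}(β)` solve the Vandermonde system that defines them. -/
theorem coeffC_vandermonde (k : ℕ) (hk : k = 2 ∨ k = 3 ∨ k = 4) (β : ℝ) (m : ℕ) (hm : m < k) :
    ∑ q ∈ Finset.range k, coeffC k q β * (β + ((k - 1 - q : ℕ) : ℝ)) ^ m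
      = if m = 0 then 1 else 0 := by
  rcases hk with rfl | rfl | rfl <;> interval_cases m <;>
    norm_num [Finset.sum_range_succ, coeffC] <;> ring

/-- The constants `η_k(β)`, `k = 2, 3, 4`. -/
noncomputable def eta : ℕ → ℝ → ℝ
  | 2, β => (β - 1) / β
  | 3, β => (β - 1) / (β + 1)
  | 4, β => (β - 1) / (β + 3)
  | _, _ => 0

section Operators

variable {E : Type*} [AddCommGroup E] [Module ℝ E]

/-- `A_k^β(x^i) = ∑_{q=0}^{k} a_{k,q}(β) x^{i-k+q}`; only used for `i ≥ k`. -/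
noncomputable def opA (k : ℕ) (β : ℝ) (x : ℕ → E) (i : ℕ) : E :=
  ∑ q ∈ Finset.range (k + 1), coeffA k q β • x (i + q - k)

/-- `B_k^β(x^i) = ∑_{q=0}^{k-1} b_{k,q}(β) x^{i-k+1+q}`; only used for `i + 1 ≥ k`. -/
noncomputable def opB (k : ℕ) (β : ℝ) (x : ℕ → E) (i : ℕ) : E :=
  ∑ q ∈ Finset.range k, coeffB k q β • x (i + 1 + q - k)

/-- `C_k^β(x^i) = ∑_{q=0}^{k-1} c_{k,q}(β) x^{i-k+1+q}`; only used for `i + 1 ≥ k`. -/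
noncomputable def opC (k : ℕ) (β : ℝ) (x : ℕ → E) (i : ℕ) : E :=
  ∑ q ∈ Finset.range k, coeffC k q β • x (i + 1 + q - k)

end Operators

section Problem

variable {V H : Type*} [NormedAddCommGroup V] [InnerProductSpace ℝ V]
  [NormedAddCommGroup H] [InnerProductSpace ℝ H]

/-- The embedding `H = H' → V'` dual to the embedding `ι : V → H`: `h` acts by `v ↦ (h, ι v)`. -/
noncomputable def toDual (ι : V →L[ℝ] H) (h : H) : StrongDual ℝ V :=
  (innerSL ℝ h).comp ι

/-- `u` is a (strong) solution of `u_t + L u + G(u) = f` on `[0, T]`: it is continuous with values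
in `V`, differentiable with values in `H` on `(0, T)`, and satisfies the equation in `V'`. -/
structure IsSolution (ι : V →L[ℝ] H) (L : V →ₗ[ℝ] StrongDual ℝ V) (G : V → StrongDual ℝ V)
    (f : ℝ → StrongDual ℝ V) (T : ℝ) (u : ℝ → V) : Prop where
  continuousOn : ContinuousOn u (Set.Icc 0 T)
  differentiableAt : ∀ t ∈ Set.Ioo 0 T, DifferentiableAt ℝ (fun s => ι (u s)) t
  equation : ∀ t ∈ Set.Ioo 0 T,
    toDual ι (deriv (fun s => ι (u s)) t) + L (u t) + G (u t) = f t

/-- The local Lipschitz condition in the unit balls around `u t`, `t ∈ [0, T]`. The norm of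
`StrongDual ℝ V` is the dual norm `‖·‖_⋆`. -/
def LocalLipschitz (ι : V →L[ℝ] H) (G : V → StrongDual ℝ V) (T : ℝ) (u : ℝ → V)
    (γ μ : ℝ) : Prop :=
  ∀ t ∈ Set.Icc 0 T, ∀ v ∈ Metric.closedBall (u t) 1, ∀ w ∈ Metric.closedBall (u t) 1,
    ‖G v - G w‖ ^ 2 ≤ γ * ‖v - w‖ ^ 2 + μ * ‖ι (v - w)‖ ^ 2

/-- The truncation error `E_k^{n+1} = Δt u_t(t^{n+β}) - A_k^β(u(t^{n+1}))`, an element of `H`. -/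
noncomputable def truncE (ι : V →L[ℝ] H) (u : ℝ → V) (k : ℕ) (β Δt : ℝ) (n : ℕ) : H :=
  Δt • deriv (fun s => ι (u s)) ((n + β) * Δt)
    - opA k β (fun j : ℕ => ι (u (j * Δt))) (n + 1)

/-- The truncation error `R_k^{n+1} = u(t^{n+β}) - B_k^β(u(t^{n+1}))`. -/
noncomputable def truncR (u : ℝ → V) (k : ℕ) (β Δt : ℝ) (n : ℕ) : V :=
  u ((n + β) * Δt) - opB k β (fun j : ℕ => u (j * Δt)) (n + 1)

/-- The truncation error `P_k^n = u(t^{n+β}) - C_k^β(u(t^n))`. -/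
noncomputable def truncP (u : ℝ → V) (k : ℕ) (β Δt : ℝ) (n : ℕ) : V :=
  u ((n + β) * Δt) - opC k β (fun j : ℕ => u (j * Δt)) n

/-- The truncation errors are of optimal order, uniformly in `n` and in all small `Δt`. -/
def TruncationErrorBound (ι : V →L[ℝ] H) (u : ℝ → V) (T : ℝ) (k : ℕ) (β : ℝ) : Prop :=
  ∃ C > 0, ∃ τ > 0, ∀ Δt : ℝ, 0 < Δt → Δt ≤ τ → ∀ n : ℕ, k ≤ n + 1 → (n + 1) * Δt ≤ T →
    ‖truncE ι u k β Δt n‖ ^ 2 ≤ C * Δt ^ (2 * k + 2) ∧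
    ‖truncR u k β Δt n‖ ^ 2 ≤ C * Δt ^ (2 * k) ∧
    ‖truncP u k β Δt n‖ ^ 2 ≤ C * Δt ^ (2 * k)

/-- The sequence `φ` satisfies the IMEX scheme of order `k` with step size `Δt`:
`A_k^β(φ^{n+1}) / Δt + L B_k^β(φ^{n+1}) + G(C_k^β(φ^n)) = f(t^{n+β})` in `V'`,
for all `n ≥ k - 1` with `t^{n+1} ≤ T`. -/
def SolvesScheme (ι : V →L[ℝ] H) (L : V →ₗ[ℝ] StrongDual ℝ V) (G : V → StrongDual ℝ V)
    (f : ℝ → StrongDual ℝ V) (T : ℝ) (k : ℕ) (β Δt : ℝ) (φ : ℕ → V) : Prop :=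
  ∀ n : ℕ, k ≤ n + 1 → (n + 1) * Δt ≤ T →
    (1 / Δt) • toDual ι (ι (opA k β φ (n + 1))) + L (opB k β φ (n + 1)) + G (opC k β φ n)
      = f ((n + β) * Δt)

/-- The starting values: `φ^0 = u(0)`; the values `φ^1, …, φ^{k-1}` are accurate of order `k` in
`H` and in `V` with constant `C₀`; the first extrapolated value is in the unit ball around `u`. -/
structure InitialSteps (ι : V →L[ℝ] H) (u : ℝ → V) (k : ℕ) (β Δt C₀ : ℝ) (φ : ℕ → V) :
    Prop where
  zero : φ 0 = u 0
  accurate : ∀ i : ℕ, 1 ≤ i → i ≤ k - 1 →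
    ‖ι (φ i - u (i * Δt))‖ ^ 2 ≤ C₀ * Δt ^ (2 * k) ∧ ‖φ i - u (i * Δt)‖ ^ 2 ≤ C₀ * Δt ^ (2 * k)
  mem_ball : opC k β φ (k - 1) ∈ Metric.closedBall (u (((k : ℝ) - 1 + β) * Δt)) 1

end Problem

end IMEX

/-! The proof is an energy argument in the spirit of G-stability, with the multiplier
`C_k^β(e^{n+1})`. Subtracting the equation for `u` at `t^{n+β}` from the scheme gives an error
equation with right-hand side `E`, `R` and the difference of the values of `G` at `C_k^β(φ^n)` and
at `u(t^{n+β})`.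

Two algebraic facts make the multiplier work. There is a positive definite quadratic form in the
last `k` errors whose increment is at most `(A e, C e)`, and a nonnegative one whose increment is at
most `(B e, C e) - η_k ‖C e‖²` (`exists_energyA`, `exists_energyB`). The first is used in `H`, the
second in `V`, where `L` is the Riesz map. Both are explicit matrices in the backward differences
`∇^i e`: the defect of each inequality is a sum of squares with weights polynomial in `β`, and
definiteness follows from positive pivots.

The Lipschitz condition bounds the nonlinear term by `√γ ‖C e^n‖ ‖C e^{n+1}‖` plus lower order
terms. Half of each square goes to either time level, so this costs `√γ ‖C e‖²` in total; since `η_k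
- √γ ≥ ρ`, a multiple `ρ` of `‖C e‖²` remains, of which half absorbs the perturbations and half is
summed (`energy_step`).

As the Lipschitz condition is only local, each step needs `C_k^β(φ^n)` near `u`. The bound already
obtained at level `n` gives `‖C e^n‖² = O(Δt^{2k-1})`, which for small `Δt` keeps the extrapolation
in the ball, so induction and Gronwall run together (`discrete_gronwall_of_bound`).

Part (a) is Taylor expansion about the oldest node, combined with exactness of the three formulas on
polynomials. -/

namespace IMEX

/-! ### Quadratic forms on tuples of vectors and elimination -/

section InnerForm

variable {E : Type*} [NormedAddCommGroup E] [InnerProductSpace ℝ E]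

/-- The quadratic form `∑ M i j (x i, x j)` on tuples of vectors. -/
noncomputable def innerForm {n : ℕ} (M : Matrix (Fin n) (Fin n) ℝ) (x : Fin n → E) : ℝ :=
  ∑ i, ∑ j, M i j * inner ℝ (x i) (x j)

/-- The Schur complement of the upper left entry, multiplied by this entry. -/
def schur {n : ℕ} (M : Matrix (Fin (n + 1)) (Fin (n + 1)) ℝ) : Matrix (Fin n) (Fin n) ℝ :=
  fun i j => M 0 0 * M i.succ j.succ - M 0 i.succ * M 0 j.succ

/-- All pivots of fraction-free symmetric elimination are positive. -/
def PivotsPos : (n : ℕ) → Matrix (Fin n) (Fin n) ℝ → Prop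
  | 0, _ => True
  | n + 1, M => 0 < M 0 0 ∧ PivotsPos n (schur M)

theorem norm_sum_smul_sq_le {ι : Type*} (s : Finset ι) (a : ι → ℝ) (x : ι → E) :
    ‖∑ i ∈ s, a i • x i‖ ^ 2 ≤ (∑ i ∈ s, a i ^ 2) * ∑ i ∈ s, ‖x i‖ ^ 2 := by
  have h1 : ‖∑ i ∈ s, a i • x i‖ ≤ ∑ i ∈ s, |a i| * ‖x i‖ := by
    refine (norm_sum_le _ _).trans (le_of_eq ?_)
    simp [norm_smul]
  have h2 := Finset.sum_mul_sq_le_sq_mul_sq s (fun i => |a i|) (fun i => ‖x i‖)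
  simp only [sq_abs] at h2
  exact (pow_le_pow_left₀ (norm_nonneg _) h1 2).trans h2

/-- Completing the square in `x 0`; multiplying by the pivot avoids division. -/
theorem mul_innerForm_succ {n : ℕ} {M : Matrix (Fin (n + 1)) (Fin (n + 1)) ℝ}
    (hM : ∀ i j, M i j = M j i) (x : Fin (n + 1) → E) :
    M 0 0 * innerForm M x = ‖M 0 0 • x 0 + ∑ i : Fin n, M 0 i.succ • x i.succ‖ ^ 2
      + innerForm (schur M) (fun i => x i.succ) := by
  rw [norm_add_sq_real, ← real_inner_self_eq_norm_sq, ← real_inner_self_eq_norm_sq]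
  simp only [innerForm, schur, Fin.sum_univ_succ, sum_inner, inner_sum, real_inner_smul_left,
    real_inner_smul_right, sub_mul, Finset.sum_sub_distrib, mul_add, Finset.mul_sum,
    Finset.sum_add_distrib]
  have e1 : ∀ i : Fin n, M 0 0 * (M i.succ 0 * inner ℝ (x i.succ) (x 0))
      = M 0 0 * (M 0 i.succ * inner ℝ (x 0) (x i.succ)) := fun i => by
    rw [hM i.succ 0, real_inner_comm]
  simp only [e1]
  have e2 : ∑ i : Fin n, 2 * (M 0 i.succ * (M 0 0 * inner ℝ (x 0) (x i.succ)))
      = 2 * ∑ i : Fin n, M 0 0 * (M 0 i.succ * inner ℝ (x 0) (x i.succ)) := by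
    rw [Finset.mul_sum]; exact Finset.sum_congr rfl fun i _ => by ring
  have e4 : ∑ i : Fin n, ∑ j : Fin n, M 0 0 * (M i.succ j.succ * inner ℝ (x i.succ) (x j.succ))
      = ∑ i : Fin n, ∑ j : Fin n, M 0 0 * M i.succ j.succ * inner ℝ (x i.succ) (x j.succ) :=
    Finset.sum_congr rfl fun i _ => Finset.sum_congr rfl fun j _ => by ring
  have e5 : ∑ i : Fin n, ∑ j : Fin n, M 0 i.succ * (M 0 j.succ * inner ℝ (x j.succ) (x i.succ))
      = ∑ i : Fin n, ∑ j : Fin n, M 0 i.succ * M 0 j.succ * inner ℝ (x i.succ) (x j.succ) :=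
    Finset.sum_congr rfl fun i _ => Finset.sum_congr rfl fun j _ => by
      rw [real_inner_comm]; ring
  rw [e2, e5, e4]
  ring

/-- Induction on the size, splitting off one square at a time. No passage through eigenvalues is
needed, and the argument works for vectors of any inner product space. -/
theorem PivotsPos.exists_coercive : ∀ (n : ℕ) (M : Matrix (Fin n) (Fin n) ℝ),
    (∀ i j, M i j = M j i) → PivotsPos n M →
    ∃ c > 0, ∀ x : Fin n → E, c * ∑ i, ‖x i‖ ^ 2 ≤ innerForm M x
  | 0, _, _, _ => ⟨1, one_pos, fun x => by simp [innerForm]⟩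
  | n + 1, M, hM, hp => by
    obtain ⟨c', hc', h'⟩ := PivotsPos.exists_coercive n (schur M)
      (fun i j => by simp only [schur]; rw [hM i.succ j.succ]; ring) hp.2
    have ha : 0 < M 0 0 := hp.1
    set a := M 0 0 with ha_def
    set N := ∑ i : Fin n, M 0 i.succ ^ 2 with hN
    have hN0 : 0 ≤ N := Finset.sum_nonneg fun i _ => sq_nonneg _
    have hd : 0 < 2 * N / a + a := by positivity
    -- With `Z` the completed square and `S` the sum over the remaining vectors, `a² ‖x 0‖² ≤ 2 Z +
    -- 2 N S`. The first bound on `c` lets `Z` absorb its part, the second lets `c' S` absorb the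
    -- terms in `S`.
    refine ⟨min (a / 2) (c' / (2 * N / a + a)), lt_min (by positivity) (by positivity), fun x => ?_⟩
    set c := min (a / 2) (c' / (2 * N / a + a)) with hc
    have hc0 : 0 < c := lt_min (by positivity) (by positivity)
    have hc1 : c ≤ a / 2 := min_le_left _ _
    have hc2 : c * (2 * N / a + a) ≤ c' := by
      rw [← le_div_iff₀ hd]; exact min_le_right _ _
    have key := mul_innerForm_succ hM x
    have hs := h' (fun i => x i.succ)
    have hy := norm_sum_smul_sq_le Finset.univ (fun i : Fin n => M 0 i.succ) (fun i => x i.succ)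
    rw [← ha_def] at key
    set y := ∑ i : Fin n, M 0 i.succ • x i.succ
    set S := ∑ i : Fin n, ‖x i.succ‖ ^ 2
    have hS : 0 ≤ S := Finset.sum_nonneg fun i _ => sq_nonneg _
    set Z := ‖a • x 0 + y‖ ^ 2
    have hx : a ^ 2 * ‖x 0‖ ^ 2 ≤ 2 * Z + 2 * (N * S) := by
      have h1 : ‖a • x 0‖ ≤ ‖a • x 0 + y‖ + ‖y‖ := by
        simpa using norm_sub_le (a • x 0 + y) y
      have h2 : ‖a • x 0‖ ^ 2 = a ^ 2 * ‖x 0‖ ^ 2 := by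
        rw [norm_smul, mul_pow, Real.norm_eq_abs, sq_abs]
      have h3 := pow_le_pow_left₀ (norm_nonneg _) h1 2
      nlinarith [sq_nonneg (‖a • x 0 + y‖ - ‖y‖)]
    rw [Fin.sum_univ_succ]
    have hZ : 0 ≤ Z := sq_nonneg _
    refine le_of_mul_le_mul_left ?_ ha
    rw [key]
    have h4 : a * (c * ‖x 0‖ ^ 2) ≤ c / a * (2 * Z + 2 * (N * S)) := by
      calc a * (c * ‖x 0‖ ^ 2) = c / a * (a ^ 2 * ‖x 0‖ ^ 2) := by field_simp
        _ ≤ _ := mul_le_mul_of_nonneg_left hx (by positivity)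
    have h5 : c / a * (2 * Z) ≤ Z := by
      have : c / a ≤ 1 / 2 := by rw [div_le_iff₀ ha]; linarith
      nlinarith
    have h6 : c / a * (2 * (N * S)) + a * (c * S) = c * (2 * N / a + a) * S := by
      field_simp
    have h7 := mul_le_mul_of_nonneg_right hc2 hS
    calc a * (c * (‖x 0‖ ^ 2 + S)) = a * (c * ‖x 0‖ ^ 2) + a * (c * S) := by ring
      _ ≤ c / a * (2 * Z) + (c / a * (2 * (N * S)) + a * (c * S)) := by linarith
      _ ≤ Z + c' * S := by rw [h6]; linarith
      _ ≤ _ := by linarith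

theorem exists_innerForm_le {n : ℕ} (M : Matrix (Fin n) (Fin n) ℝ) :
    ∃ K ≥ 0, ∀ (x : Fin n → E) (b : ℝ), (∀ i, ‖x i‖ ^ 2 ≤ b) → innerForm M x ≤ K * b := by
  refine ⟨∑ i, ∑ j, |M i j|, by positivity, fun x b hb => ?_⟩
  rw [innerForm, Finset.sum_mul]
  refine Finset.sum_le_sum fun i _ => ?_
  rw [Finset.sum_mul]
  refine Finset.sum_le_sum fun j _ => ?_
  refine (le_abs_self _).trans ?_
  rw [abs_mul]
  refine mul_le_mul_of_nonneg_left ?_ (abs_nonneg _)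
  have h1 := abs_real_inner_le_norm (x i) (x j)
  nlinarith [hb i, hb j, sq_nonneg (‖x i‖ - ‖x j‖)]

end InnerForm

/-! ### Backward differences -/

section BackDiff

variable {E : Type*} [AddCommGroup E]

/-- The backward differences `∇^i x` of a sequence. -/
def backDiff : ℕ → (ℕ → E) → ℕ → E
  | 0, x, n => x n
  | i + 1, x, n => backDiff i x n - backDiff i x (n - 1)

/-- With `e i = ∇^i x^{n+1}`, the differences at level `n` are `e i - e (i + 1)`. Increments of the
energies thus become algebraic expressions in independent vectors `e i`. -/
theorem backDiff_pred (i : ℕ) (x : ℕ → E) (n : ℕ) :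
    backDiff i x n = backDiff i x (n + 1) - backDiff (i + 1) x (n + 1) := by
  simp [backDiff]

end BackDiff

theorem norm_backDiff_le {E : Type*} [NormedAddCommGroup E] {x : ℕ → E} {b : ℝ} :
    ∀ (i n : ℕ), (∀ j ≤ n, ‖x j‖ ≤ b) → ‖backDiff i x n‖ ≤ 2 ^ i * b
  | 0, n, h => by simpa [backDiff] using h n le_rfl
  | i + 1, n, h => by
    have h1 := norm_backDiff_le i n h
    have h2 := norm_backDiff_le i (n - 1) fun j hj => h j (hj.trans (Nat.sub_le _ _))
    calc ‖backDiff (i + 1) x n‖ ≤ ‖backDiff i x n‖ + ‖backDiff i x (n - 1)‖ := norm_sub_le _ _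
      _ ≤ 2 ^ (i + 1) * b := by rw [pow_succ]; linarith

/-- The coefficients of `C_k^β` with respect to the backward differences. -/
noncomputable def diffC : ℕ → ℝ → ℝ
  | 0, _ => 1
  | 1, β => β
  | 2, β => β * (β + 1) / 2
  | 3, β => β * (β + 1) * (β + 2) / 6
  | _, _ => 0

/-- The coefficients of `A_k^β` with respect to the backward differences. -/
noncomputable def diffA : ℕ → ℝ → ℝ
  | 1, _ => 1
  | 2, β => β - 1 / 2
  | 3, β => (3 * β ^ 2 - 1) / 6
  | 4, β => (2 * β ^ 3 + 3 * β ^ 2 - β - 1) / 12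
  | _, _ => 0

/-- The denominators of the constants `η_k(β)`. -/
noncomputable def etaDen : ℕ → ℝ → ℝ
  | 2, β => β
  | 3, β => β + 1
  | 4, β => β + 3
  | _, _ => 1

section Conversion

variable {E : Type*} [AddCommGroup E] [Module ℝ E]

/-- Newton's backward extrapolation to `t^{n+β}`: the coefficient of `∇^i` is the binomial `β (β +
1) ⋯ (β + i - 1) / i!`, independent of `k`. Since `B` starts from the level `n + 1`, it has the same
coefficients at `β - 1`, and those of `A` are their derivatives there. -/
theorem opC_eq_sum_backDiff {k : ℕ} (hk : k = 2 ∨ k = 3 ∨ k = 4) (β : ℝ) (x : ℕ → E) {n : ℕ}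
    (hn : k ≤ n + 1) :
    opC k β x n = ∑ i ∈ Finset.range k, diffC i β • backDiff i x n := by
  obtain ⟨m, rfl⟩ : ∃ m, n = m + (k - 1) := ⟨n - (k - 1), by omega⟩
  rcases hk with rfl | rfl | rfl <;>
  · simp [opC, Finset.sum_range_succ, coeffC, diffC, backDiff]
    module

theorem opB_eq_sum_backDiff {k : ℕ} (hk : k = 2 ∨ k = 3 ∨ k = 4) (β : ℝ) (x : ℕ → E) {n : ℕ}
    (hn : k ≤ n + 1) :
    opB k β x n = ∑ i ∈ Finset.range k, diffC i (β - 1) • backDiff i x n := by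
  obtain ⟨m, rfl⟩ : ∃ m, n = m + (k - 1) := ⟨n - (k - 1), by omega⟩
  rcases hk with rfl | rfl | rfl <;>
  · simp [opB, Finset.sum_range_succ, coeffB, diffC, backDiff]
    module

theorem opA_eq_sum_backDiff {k : ℕ} (hk : k = 2 ∨ k = 3 ∨ k = 4) (β : ℝ) (x : ℕ → E) {n : ℕ}
    (hn : k ≤ n) :
    opA k β x n = ∑ i ∈ Finset.range (k + 1), diffA i β • backDiff i x n := by
  obtain ⟨m, rfl⟩ : ∃ m, n = m + k := ⟨n - k, by omega⟩
  rcases hk with rfl | rfl | rfl <;>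
  · simp [opA, Finset.sum_range_succ, coeffA, diffA, backDiff]
    module

end Conversion

/-- The matrix of the `G`-norm for `A_2^β` and `C_2^β`. -/
noncomputable def energyA_two (β : ℝ) : Matrix (Fin 2) (Fin 2) ℝ :=
  !![1 / 2, 1 / 2 * β - 1 / 4;
    1 / 2 * β - 1 / 4, 1 / 2 * β ^ 2 + 1 / 4 * β - 1 / 4]

/-- The matrix of the `G`-norm for `A_3^β` and `C_3^β`. -/
noncomputable def energyA_three (β : ℝ) : Matrix (Fin 3) (Fin 3) ℝ :=
  !![1 / 2, 1 / 2 * β - 1 / 4, 1 / 4 * β ^ 2 - 1 / 12;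
    1 / 2 * β - 1 / 4, 1 / 2 * β ^ 2 + 1 / 2 * β - 1 / 6,
      1 / 4 * β ^ 3 + 1 / 4 * β ^ 2 - 1 / 12 * β - 1 / 12;
    1 / 4 * β ^ 2 - 1 / 12, 1 / 4 * β ^ 3 + 1 / 4 * β ^ 2 - 1 / 12 * β - 1 / 12,
      1 / 8 * β ^ 4 + 3 / 8 * β ^ 3 + 5 / 24 * β ^ 2 - 1 / 8 * β - 1 / 12]

/-- The matrix of the `G`-norm for `A_4^β` and `C_4^β`. -/
noncomputable def energyA_four (β : ℝ) : Matrix (Fin 4) (Fin 4) ℝ :=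
  !![1 / 2, 1 / 2 * β - 1 / 4, 1 / 4 * β ^ 2 - 1 / 12,
      1 / 12 * β ^ 3 + 1 / 8 * β ^ 2 - 1 / 24 * β - 1 / 24;
    1 / 2 * β - 1 / 4, 1 / 2 * β ^ 2 + 1 / 2 * β,
      1 / 4 * β ^ 3 + 3 / 8 * β ^ 2 + 1 / 8 * β - 1 / 24,
      1 / 12 * β ^ 4 + 5 / 24 * β ^ 3 + 1 / 12 * β ^ 2 - 1 / 12 * β - 1 / 24;
    1 / 4 * β ^ 2 - 1 / 12, 1 / 4 * β ^ 3 + 3 / 8 * β ^ 2 + 1 / 8 * β - 1 / 24,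
      1 / 8 * β ^ 4 + 3 / 8 * β ^ 3 + 7 / 24 * β ^ 2 + 1 / 12 * β,
      1 / 24 * β ^ 5 + 3 / 16 * β ^ 4 + 1 / 4 * β ^ 3 + 1 / 24 * β ^ 2 - 5 / 48 * β - 1 / 24;
    1 / 12 * β ^ 3 + 1 / 8 * β ^ 2 - 1 / 24 * β - 1 / 24,
      1 / 12 * β ^ 4 + 5 / 24 * β ^ 3 + 1 / 12 * β ^ 2 - 1 / 12 * β - 1 / 24,
      1 / 24 * β ^ 5 + 3 / 16 * β ^ 4 + 1 / 4 * β ^ 3 + 1 / 24 * β ^ 2 - 5 / 48 * β - 1 / 24,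
      1 / 72 * β ^ 6 + 5 / 48 * β ^ 5 + 13 / 48 * β ^ 4 + 19 / 72 * β ^ 3 + 1 / 144 * β ^ 2
        - 17 / 144 * β - 1 / 24]

/-- The matrix of the `G`-norm for `B_2^β - η_2(β) C_2^β` and `C_2^β`, up to a factor. -/
noncomputable def energyB_two (β : ℝ) : Matrix (Fin 1) (Fin 1) ℝ :=
  !![1 / 2 * β]

/-- The matrix of the `G`-norm for `B_3^β - η_3(β) C_3^β` and `C_3^β`, up to a factor. -/
noncomputable def energyB_three (β : ℝ) : Matrix (Fin 2) (Fin 2) ℝ :=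
  !![3 / 2 * β - 1 / 2, 1 / 2 * β ^ 2 + 1 / 4 * β - 1 / 4;
    1 / 2 * β ^ 2 + 1 / 4 * β - 1 / 4, 1 / 4 * β ^ 3 + 1 / 2 * β ^ 2 - 1 / 4]

/-- The matrix of the `G`-norm for `B_4^β - η_4(β) C_4^β` and `C_4^β`, up to a factor. -/
noncomputable def energyB_four (β : ℝ) : Matrix (Fin 3) (Fin 3) ℝ :=
  !![14 * β ^ 3 + 24 * β ^ 2 + 27 / 2 * β + 5 / 2,
      39 / 8 * β ^ 4 + 13 / 16 * β ^ 3 - 161 / 16 * β ^ 2 - 49 / 8 * β - 3 / 4,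
      5 / 3 * β ^ 5 + 17 / 3 * β ^ 4 + 27 / 4 * β ^ 3 + 10 / 3 * β ^ 2 + 7 / 12 * β;
    39 / 8 * β ^ 4 + 13 / 16 * β ^ 3 - 161 / 16 * β ^ 2 - 49 / 8 * β - 3 / 4,
      10 / 3 * β ^ 5 + 67 / 12 * β ^ 4 + 79 / 8 * β ^ 3 + 379 / 24 * β ^ 2 + 71 / 12 * β,
      5 / 6 * β ^ 6 + 3 / 2 * β ^ 5 - 47 / 24 * β ^ 4 - 16 / 3 * β ^ 3 - 27 / 8 * β ^ 2
        - 2 / 3 * β;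
    5 / 3 * β ^ 5 + 17 / 3 * β ^ 4 + 27 / 4 * β ^ 3 + 10 / 3 * β ^ 2 + 7 / 12 * β,
      5 / 6 * β ^ 6 + 3 / 2 * β ^ 5 - 47 / 24 * β ^ 4 - 16 / 3 * β ^ 3 - 27 / 8 * β ^ 2
        - 2 / 3 * β,
      1 / 2 * β ^ 7 + 8 / 3 * β ^ 6 + 131 / 24 * β ^ 5 + 133 / 24 * β ^ 4 + 71 / 24 * β ^ 3
        + 19 / 24 * β ^ 2 + 1 / 12 * β]

/-! ### Positive definiteness of the energy matrices -/

theorem energyA_two_symm (β : ℝ) (i j : Fin 2) :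
    energyA_two β i j = energyA_two β j i := by
  fin_cases i <;> fin_cases j <;> rfl

/-- Here and below, each pivot becomes a polynomial with positive coefficients in the distance `s`
of `β` to the left end of its range. -/
theorem energyA_two_pivotsPos {β : ℝ} (hβ : 1 ≤ β) : PivotsPos 2 (energyA_two β) := by
  obtain ⟨s, rfl⟩ : ∃ s, β = 1 + s := ⟨β - 1, by ring⟩
  have hs : 0 ≤ s := by linarith
  refine ⟨?_, ?_, trivial⟩
  all_goals
    simp [schur, energyA_two, -sub_pos]
    try (ring_nf; positivity)

theorem energyB_two_symm (β : ℝ) (i j : Fin 1) :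
    energyB_two β i j = energyB_two β j i := by
  fin_cases i; fin_cases j; rfl

theorem energyB_two_pivotsPos {β : ℝ} (hβ : 1 ≤ β) : PivotsPos 1 (energyB_two β) := by
  obtain ⟨s, rfl⟩ : ∃ s, β = 1 + s := ⟨β - 1, by ring⟩
  have hs : 0 ≤ s := by linarith
  refine ⟨?_, trivial⟩
  simp [energyB_two]
  positivity

theorem energyA_three_symm (β : ℝ) (i j : Fin 3) :
    energyA_three β i j = energyA_three β j i := by
  fin_cases i <;> fin_cases j <;> rfl

theorem energyA_three_pivotsPos {β : ℝ} (hβ : 1 ≤ β) : PivotsPos 3 (energyA_three β) := by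
  obtain ⟨s, rfl⟩ : ∃ s, β = 1 + s := ⟨β - 1, by ring⟩
  have hs : 0 ≤ s := by linarith
  refine ⟨?_, ?_, ?_, trivial⟩
  all_goals
    simp [schur, energyA_three, -sub_pos]
    try (ring_nf; positivity)

theorem energyB_three_symm (β : ℝ) (i j : Fin 2) :
    energyB_three β i j = energyB_three β j i := by
  fin_cases i <;> fin_cases j <;> rfl

theorem energyB_three_pivotsPos {β : ℝ} (hβ : 1 ≤ β) : PivotsPos 2 (energyB_three β) := by
  obtain ⟨s, rfl⟩ : ∃ s, β = 1 + s := ⟨β - 1, by ring⟩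
  have hs : 0 ≤ s := by linarith
  refine ⟨?_, ?_, trivial⟩
  all_goals
    simp [schur, energyB_three, -sub_pos]
    try (ring_nf; positivity)

theorem energyA_four_symm (β : ℝ) (i j : Fin 4) :
    energyA_four β i j = energyA_four β j i := by
  fin_cases i <;> fin_cases j <;> rfl

theorem energyA_four_pivotsPos {β : ℝ} (hβ : 2 ≤ β) : PivotsPos 4 (energyA_four β) := by
  obtain ⟨s, rfl⟩ : ∃ s, β = 2 + s := ⟨β - 2, by ring⟩
  have hs : 0 ≤ s := by linarith
  refine ⟨?_, ?_, ?_, ?_, trivial⟩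
  all_goals
    simp [schur, energyA_four, -sub_pos]
    try (ring_nf; positivity)

theorem energyB_four_symm (β : ℝ) (i j : Fin 3) :
    energyB_four β i j = energyB_four β j i := by
  fin_cases i <;> fin_cases j <;> rfl

theorem energyB_four_pivotsPos {β : ℝ} (hβ : 2 ≤ β) : PivotsPos 3 (energyB_four β) := by
  obtain ⟨s, rfl⟩ : ∃ s, β = 2 + s := ⟨β - 2, by ring⟩
  have hs : 0 ≤ s := by linarith
  refine ⟨?_, ?_, ?_, trivial⟩
  all_goals
    simp [schur, energyB_four, -sub_pos]
    try (ring_nf; positivity)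

/-! ### Sum-of-squares identities behind the multiplier -/

section Identities

variable {E : Type*} [NormedAddCommGroup E] [InnerProductSpace ℝ E]

/-- In this and the following inequalities, `e i` stands for `∇^i x^{n+1}`. The identity `key`
exhibits the defect as a sum of squares with nonnegative weights. -/
theorem energyA_two_sub_le {β : ℝ} (hβ : 1 ≤ β) (e : ℕ → E) :
    innerForm (energyA_two β) (fun i => e i)
        - innerForm (energyA_two β) (fun i => e i - e (i + 1))
      ≤ inner ℝ (∑ i ∈ Finset.range 3, diffA i β • e i)
        (∑ i ∈ Finset.range 2, diffC i β • e i) := by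
  have hw0 : 0 ≤ 1 / 2 * β ^ 2 + 1 / 4 * β - 1 / 4 := by
    obtain ⟨s, rfl⟩ : ∃ s, β = 1 + s := ⟨β - 1, by ring⟩
    have hs : 0 ≤ s := by linarith
    ring_nf
    positivity
  have h10 : inner ℝ (e 1) (e 0) = inner ℝ (e 0) (e 1) := real_inner_comm _ _
  have h20 : inner ℝ (e 2) (e 0) = inner ℝ (e 0) (e 2) := real_inner_comm _ _
  have h21 : inner ℝ (e 2) (e 1) = inner ℝ (e 1) (e 2) := real_inner_comm _ _
  have key : inner ℝ (∑ i ∈ Finset.range 3, diffA i β • e i)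
        (∑ i ∈ Finset.range 2, diffC i β • e i)
      = innerForm (energyA_two β) (fun i => e i)
        - innerForm (energyA_two β) (fun i => e i - e (i + 1))
      + ‖e 1‖ ^ 2
      + (1 / 2 * β ^ 2 + 1 / 4 * β - 1 / 4) * ‖e 2‖ ^ 2 := by
    simp only [innerForm, Fin.sum_univ_two, Finset.sum_range_succ, Finset.sum_range_zero, diffA, diffC,
      energyA_two, ← real_inner_self_eq_norm_sq, inner_add_left, inner_add_right,
      inner_sub_left, inner_sub_right,
      real_inner_smul_left, real_inner_smul_right, zero_add, one_smul, zero_smul]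
    simp [h10, h20, h21]
    ring
  rw [key]
  linarith [sq_nonneg ‖e 1‖,
    mul_nonneg hw0 (sq_nonneg ‖e 2‖)]

/-- Multiplying `(B, C) - η_k ‖C‖²` by the denominator of `η_k` gives the right-hand side. The
highest difference `∇^{k-1}` already occurs in `B` and `C`, so the energy involves only `k - 1`
differences. -/
theorem energyB_two_sub_le {β : ℝ} (hβ : 1 ≤ β) (e : ℕ → E) :
    innerForm (energyB_two β) (fun i => e i)
        - innerForm (energyB_two β) (fun i => e i - e (i + 1))
      ≤ ((etaDen 2 β * inner ℝ (∑ i ∈ Finset.range 2, diffC i (β - 1) • e i)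
          (∑ i ∈ Finset.range 2, diffC i β • e i)
        - (β - 1) * ‖∑ i ∈ Finset.range 2, diffC i β • e i‖ ^ 2)) := by
  have hw0 : 0 ≤ β / 2 := by
    obtain ⟨s, rfl⟩ : ∃ s, β = 1 + s := ⟨β - 1, by ring⟩
    have hs : 0 ≤ s := by linarith
    ring_nf
    positivity
  have h10 : inner ℝ (e 1) (e 0) = inner ℝ (e 0) (e 1) := real_inner_comm _ _
  have key : ((etaDen 2 β * inner ℝ (∑ i ∈ Finset.range 2, diffC i (β - 1) • e i)
          (∑ i ∈ Finset.range 2, diffC i β • e i)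
        - (β - 1) * ‖∑ i ∈ Finset.range 2, diffC i β • e i‖ ^ 2))
      = innerForm (energyB_two β) (fun i => e i)
        - innerForm (energyB_two β) (fun i => e i - e (i + 1))
      + ‖e 0‖ ^ 2
      + (β / 2) * ‖e 1‖ ^ 2 := by
    simp only [innerForm, Fin.sum_univ_one, Finset.sum_range_succ, Finset.sum_range_zero, diffC, etaDen,
      energyB_two, ← real_inner_self_eq_norm_sq, inner_add_left, inner_add_right,
      inner_sub_left, inner_sub_right,
      real_inner_smul_left, real_inner_smul_right, zero_add, one_smul]
    simp [h10]
    ring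
  rw [key]
  linarith [sq_nonneg ‖e 0‖,
    mul_nonneg hw0 (sq_nonneg ‖e 1‖)]

theorem energyA_three_sub_le {β : ℝ} (hβ : 1 ≤ β) (e : ℕ → E) :
    innerForm (energyA_three β) (fun i => e i)
        - innerForm (energyA_three β) (fun i => e i - e (i + 1))
      ≤ inner ℝ (∑ i ∈ Finset.range 4, diffA i β • e i)
        (∑ i ∈ Finset.range 3, diffC i β • e i) := by
  have hw0 : 0 ≤ 1 / 4 * β ^ 2 + 5 / 12 * β := by
    obtain ⟨s, rfl⟩ : ∃ s, β = 1 + s := ⟨β - 1, by ring⟩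
    have hs : 0 ≤ s := by linarith
    ring_nf
    positivity
  have hw1 : 0 ≤ 1 / 8 * β ^ 4 + 3 / 8 * β ^ 3 + 5 / 24 * β ^ 2 - 1 / 8 * β - 1 / 12 := by
    obtain ⟨s, rfl⟩ : ∃ s, β = 1 + s := ⟨β - 1, by ring⟩
    have hs : 0 ≤ s := by linarith
    ring_nf
    positivity
  have h10 : inner ℝ (e 1) (e 0) = inner ℝ (e 0) (e 1) := real_inner_comm _ _
  have h20 : inner ℝ (e 2) (e 0) = inner ℝ (e 0) (e 2) := real_inner_comm _ _
  have h30 : inner ℝ (e 3) (e 0) = inner ℝ (e 0) (e 3) := real_inner_comm _ _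
  have h21 : inner ℝ (e 2) (e 1) = inner ℝ (e 1) (e 2) := real_inner_comm _ _
  have h31 : inner ℝ (e 3) (e 1) = inner ℝ (e 1) (e 3) := real_inner_comm _ _
  have h32 : inner ℝ (e 3) (e 2) = inner ℝ (e 2) (e 3) := real_inner_comm _ _
  have key : inner ℝ (∑ i ∈ Finset.range 4, diffA i β • e i)
        (∑ i ∈ Finset.range 3, diffC i β • e i)
      = innerForm (energyA_three β) (fun i => e i)
        - innerForm (energyA_three β) (fun i => e i - e (i + 1))
      + ‖e 1‖ ^ 2
      + (1 / 4 * β ^ 2 + 5 / 12 * β) * ‖e 2‖ ^ 2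
      + (1 / 8 * β ^ 4 + 3 / 8 * β ^ 3 + 5 / 24 * β ^ 2 - 1 / 8 * β - 1 / 12) * ‖e 3‖ ^ 2 := by
    simp only [innerForm, Fin.sum_univ_three, Finset.sum_range_succ, Finset.sum_range_zero, diffA, diffC,
      energyA_three, ← real_inner_self_eq_norm_sq, inner_add_left, inner_add_right,
      inner_sub_left, inner_sub_right,
      real_inner_smul_left, real_inner_smul_right, zero_add, one_smul, zero_smul]
    simp [h10, h20, h30, h21, h31, h32]
    ring
  rw [key]
  linarith [sq_nonneg ‖e 1‖,
    mul_nonneg hw0 (sq_nonneg ‖e 2‖),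
    mul_nonneg hw1 (sq_nonneg ‖e 3‖)]

theorem energyB_three_sub_le {β : ℝ} (hβ : 1 ≤ β) (e : ℕ → E) :
    innerForm (energyB_three β) (fun i => e i)
        - innerForm (energyB_three β) (fun i => e i - e (i + 1))
      ≤ ((etaDen 3 β * inner ℝ (∑ i ∈ Finset.range 3, diffC i (β - 1) • e i)
          (∑ i ∈ Finset.range 3, diffC i β • e i)
        - (β - 1) * ‖∑ i ∈ Finset.range 3, diffC i β • e i‖ ^ 2)) := by
  have hw0 : 0 ≤ 1 / 4 * β ^ 3 + 15 / 32 * β ^ 2 - 1 / 16 * β - 9 / 32 := by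
    obtain ⟨s, rfl⟩ : ∃ s, β = 1 + s := ⟨β - 1, by ring⟩
    have hs : 0 ≤ s := by linarith
    ring_nf
    positivity
  have h10 : inner ℝ (e 1) (e 0) = inner ℝ (e 0) (e 1) := real_inner_comm _ _
  have h20 : inner ℝ (e 2) (e 0) = inner ℝ (e 0) (e 2) := real_inner_comm _ _
  have h21 : inner ℝ (e 2) (e 1) = inner ℝ (e 1) (e 2) := real_inner_comm _ _
  have key : ((etaDen 3 β * inner ℝ (∑ i ∈ Finset.range 3, diffC i (β - 1) • e i)
          (∑ i ∈ Finset.range 3, diffC i β • e i)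
        - (β - 1) * ‖∑ i ∈ Finset.range 3, diffC i β • e i‖ ^ 2))
      = innerForm (energyB_three β) (fun i => e i)
        - innerForm (energyB_three β) (fun i => e i - e (i + 1))
      + (2) * ‖e 0 + ((β + 1) / 8) • e 2‖ ^ 2
      + (1 / 4 * β ^ 3 + 15 / 32 * β ^ 2 - 1 / 16 * β - 9 / 32) * ‖e 2‖ ^ 2 := by
    simp only [innerForm, Fin.sum_univ_two, Finset.sum_range_succ, Finset.sum_range_zero, diffC, etaDen,
      energyB_three, ← real_inner_self_eq_norm_sq, inner_add_left, inner_add_right,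
      inner_sub_left, inner_sub_right,
      real_inner_smul_left, real_inner_smul_right, zero_add, one_smul]
    simp [h10, h20, h21]
    ring
  rw [key]
  linarith [sq_nonneg ‖e 0 + ((β + 1) / 8) • e 2‖,
    mul_nonneg hw0 (sq_nonneg ‖e 2‖)]

theorem energyA_four_sub_le {β : ℝ} (hβ : 2 ≤ β) (e : ℕ → E) :
    innerForm (energyA_four β) (fun i => e i)
        - innerForm (energyA_four β) (fun i => e i - e (i + 1))
      ≤ inner ℝ (∑ i ∈ Finset.range 5, diffA i β • e i)
        (∑ i ∈ Finset.range 4, diffC i β • e i) := by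
  have hw0 : 0 ≤ 1 / 72 * β ^ 3 + 1 / 8 * β ^ 2 + 17 / 72 * β + 1 / 12 := by
    obtain ⟨s, rfl⟩ : ∃ s, β = 2 + s := ⟨β - 2, by ring⟩
    have hs : 0 ≤ s := by linarith
    ring_nf
    positivity
  have hw1 : 0 ≤ 1 / 72 * β ^ 6 + 5 / 48 * β ^ 5 + 13 / 48 * β ^ 4 + 19 / 72 * β ^ 3 + 1 / 144 * β ^ 2
        - 17 / 144 * β - 1 / 24 := by
    obtain ⟨s, rfl⟩ : ∃ s, β = 2 + s := ⟨β - 2, by ring⟩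
    have hs : 0 ≤ s := by linarith
    ring_nf
    positivity
  have h10 : inner ℝ (e 1) (e 0) = inner ℝ (e 0) (e 1) := real_inner_comm _ _
  have h20 : inner ℝ (e 2) (e 0) = inner ℝ (e 0) (e 2) := real_inner_comm _ _
  have h30 : inner ℝ (e 3) (e 0) = inner ℝ (e 0) (e 3) := real_inner_comm _ _
  have h40 : inner ℝ (e 4) (e 0) = inner ℝ (e 0) (e 4) := real_inner_comm _ _
  have h21 : inner ℝ (e 2) (e 1) = inner ℝ (e 1) (e 2) := real_inner_comm _ _
  have h31 : inner ℝ (e 3) (e 1) = inner ℝ (e 1) (e 3) := real_inner_comm _ _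
  have h41 : inner ℝ (e 4) (e 1) = inner ℝ (e 1) (e 4) := real_inner_comm _ _
  have h32 : inner ℝ (e 3) (e 2) = inner ℝ (e 2) (e 3) := real_inner_comm _ _
  have h42 : inner ℝ (e 4) (e 2) = inner ℝ (e 2) (e 4) := real_inner_comm _ _
  have h43 : inner ℝ (e 4) (e 3) = inner ℝ (e 3) (e 4) := real_inner_comm _ _
  have key : inner ℝ (∑ i ∈ Finset.range 5, diffA i β • e i)
        (∑ i ∈ Finset.range 4, diffC i β • e i)
      = innerForm (energyA_four β) (fun i => e i)
        - innerForm (energyA_four β) (fun i => e i - e (i + 1))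
      + (2 / 3) * ‖e 1‖ ^ 2
      + (1 / 3) * ‖e 1 - (1 / 2 : ℝ) • e 2‖ ^ 2
      + (1 / 72 * β ^ 3 + 1 / 8 * β ^ 2 + 17 / 72 * β + 1 / 12) * ‖e 3‖ ^ 2
      + (1 / 72 * β ^ 6 + 5 / 48 * β ^ 5 + 13 / 48 * β ^ 4 + 19 / 72 * β ^ 3 + 1 / 144 * β ^ 2
          - 17 / 144 * β - 1 / 24) * ‖e 4‖ ^ 2 := by
    simp only [innerForm, Fin.sum_univ_four, Finset.sum_range_succ, Finset.sum_range_zero, diffA, diffC,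
      energyA_four, ← real_inner_self_eq_norm_sq, inner_add_left, inner_add_right,
      inner_sub_left, inner_sub_right,
      real_inner_smul_left, real_inner_smul_right, zero_add, one_smul, zero_smul]
    simp [h10, h20, h30, h40, h21, h31, h41, h32, h42, h43]
    ring
  rw [key]
  linarith [sq_nonneg ‖e 1‖,
    sq_nonneg ‖e 1 - (1 / 2 : ℝ) • e 2‖,
    mul_nonneg hw0 (sq_nonneg ‖e 3‖),
    mul_nonneg hw1 (sq_nonneg ‖e 4‖)]

/-- The factor `(2 β + 1)²` makes all coefficients of the decomposition polynomial in `β`. The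
weight of `‖e 2‖²` is negative at `β = 1`, so this decomposition does not extend to all `β ≥ 1`. -/
theorem energyB_four_sub_le {β : ℝ} (hβ : 2 ≤ β) (e : ℕ → E) :
    innerForm (energyB_four β) (fun i => e i)
        - innerForm (energyB_four β) (fun i => e i - e (i + 1))
      ≤ ((2 * β + 1) ^ 2 * (etaDen 4 β * inner ℝ (∑ i ∈ Finset.range 4, diffC i (β - 1) • e i)
          (∑ i ∈ Finset.range 4, diffC i β • e i)
        - (β - 1) * ‖∑ i ∈ Finset.range 4, diffC i β • e i‖ ^ 2)) := by
  have hw0 : 0 ≤ β * (β + 2) * (β + 3) * (2 * β + 1) / 72 := by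
    obtain ⟨s, rfl⟩ : ∃ s, β = 2 + s := ⟨β - 2, by ring⟩
    have hs : 0 ≤ s := by linarith
    ring_nf
    positivity
  have hw1 : 0 ≤ 781 / 3072 * β ^ 6 + 2153 / 1536 * β ^ 5 + 1603 / 1024 * β ^ 4 - 1945 / 768 * β ^ 3
        - 3757 / 768 * β ^ 2 - 91 / 64 * β - 9 / 64 := by
    obtain ⟨s, rfl⟩ : ∃ s, β = 2 + s := ⟨β - 2, by ring⟩
    have hs : 0 ≤ s := by linarith
    ring_nf
    positivity
  have h10 : inner ℝ (e 1) (e 0) = inner ℝ (e 0) (e 1) := real_inner_comm _ _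
  have h20 : inner ℝ (e 2) (e 0) = inner ℝ (e 0) (e 2) := real_inner_comm _ _
  have h30 : inner ℝ (e 3) (e 0) = inner ℝ (e 0) (e 3) := real_inner_comm _ _
  have h21 : inner ℝ (e 2) (e 1) = inner ℝ (e 1) (e 2) := real_inner_comm _ _
  have h31 : inner ℝ (e 3) (e 1) = inner ℝ (e 1) (e 3) := real_inner_comm _ _
  have h32 : inner ℝ (e 3) (e 2) = inner ℝ (e 2) (e 3) := real_inner_comm _ _
  have key : ((2 * β + 1) ^ 2 * (etaDen 4 β * inner ℝ (∑ i ∈ Finset.range 4, diffC i (β - 1) • e i)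
          (∑ i ∈ Finset.range 4, diffC i β • e i)
        - (β - 1) * ‖∑ i ∈ Finset.range 4, diffC i β • e i‖ ^ 2))
      = innerForm (energyB_four β) (fun i => e i)
        - innerForm (energyB_four β) (fun i => e i - e (i + 1))
      + (β * (β + 2) * (β + 3) * (2 * β + 1) / 72) * ‖(9 : ℝ) • (e 1 - e 2) + ((β + 1) * (2 * β + 1)) • e 3‖ ^ 2
      + (4) * ‖(2 * β + 1) • (e 0 - e 1) + ((9 / 8 * β ^ 3 + 53 / 8 * β ^ 2 + 41 / 4 * β + 3 / 2) / 8) • e 2‖ ^ 2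
      + (781 / 3072 * β ^ 6 + 2153 / 1536 * β ^ 5 + 1603 / 1024 * β ^ 4 - 1945 / 768 * β ^ 3
          - 3757 / 768 * β ^ 2 - 91 / 64 * β - 9 / 64) * ‖e 2‖ ^ 2 := by
    simp only [innerForm, Fin.sum_univ_three, Finset.sum_range_succ, Finset.sum_range_zero, diffC, etaDen,
      energyB_four, ← real_inner_self_eq_norm_sq, inner_add_left, inner_add_right,
      inner_sub_left, inner_sub_right,
      real_inner_smul_left, real_inner_smul_right, zero_add, one_smul]
    simp [h10, h20, h30, h21, h31, h32]
    ring
  rw [key]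
  linarith [mul_nonneg hw0 (sq_nonneg ‖(9 : ℝ) • (e 1 - e 2) + ((β + 1) * (2 * β + 1)) • e 3‖),
    sq_nonneg ‖(2 * β + 1) • (e 0 - e 1) + ((9 / 8 * β ^ 3 + 53 / 8 * β ^ 2 + 41 / 4 * β + 3 / 2) / 8) • e 2‖,
    mul_nonneg hw1 (sq_nonneg ‖e 2‖)]

end Identities

/-! ### Discrete energies for sequences -/

section Energy

variable {E : Type*} [NormedAddCommGroup E] [InnerProductSpace ℝ E]

theorem innerForm_backDiff_nonneg_bounds {k : ℕ} (hk : 0 < k) {M : Matrix (Fin k) (Fin k) ℝ}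
    (hM : ∀ i j, M i j = M j i) (hp : PivotsPos k M) (a : ℕ → ℝ) :
    ∃ c > 0, ∀ (x : ℕ → E) (n : ℕ),
      c * ‖x n‖ ^ 2 ≤ innerForm M (fun i => backDiff i x n) ∧
      c * ‖∑ i ∈ Finset.range k, a i • backDiff i x n‖ ^ 2
        ≤ innerForm M (fun i => backDiff i x n) := by
  obtain ⟨c, hc, h⟩ := PivotsPos.exists_coercive (E := E) k M hM hp
  set N := ∑ i : Fin k, a i ^ 2 with hN
  have hN0 : 0 ≤ N := Finset.sum_nonneg fun i _ => sq_nonneg _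
  refine ⟨c / (1 + N), by positivity, fun x n => ?_⟩
  have hx := h fun i => backDiff i x n
  set S := ∑ i : Fin k, ‖backDiff i x n‖ ^ 2
  have hS : 0 ≤ S := Finset.sum_nonneg fun i _ => sq_nonneg _
  have h0 : ‖backDiff 0 x n‖ ^ 2 ≤ S :=
    Finset.single_le_sum (f := fun i : Fin k => ‖backDiff i x n‖ ^ 2) (fun i _ => sq_nonneg _)
      (Finset.mem_univ ⟨0, hk⟩)
  have h1 : ‖∑ i ∈ Finset.range k, a i • backDiff i x n‖ ^ 2 ≤ N * S := by
    rw [← Fin.sum_univ_eq_sum_range fun i => a i • backDiff i x n]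
    exact norm_sum_smul_sq_le Finset.univ (fun i : Fin k => a i) fun i => backDiff i x n
  have key : ∀ y, y ≤ (1 + N) * S → c / (1 + N) * y ≤ innerForm M (fun i => backDiff i x n) := by
    intro y hy
    refine le_trans ?_ hx
    rw [div_mul_eq_mul_div, div_le_iff₀ (by positivity)]
    nlinarith
  rw [backDiff] at h0
  exact ⟨key _ (by nlinarith), key _ (by nlinarith)⟩

theorem exists_innerForm_backDiff_le {m : ℕ} (M : Matrix (Fin m) (Fin m) ℝ) :
    ∃ K ≥ 0, ∀ (x : ℕ → E) (n : ℕ) (b : ℝ), (∀ j ≤ n, ‖x j‖ ≤ b) →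
      innerForm M (fun i => backDiff i x n) ≤ K * b ^ 2 := by
  obtain ⟨K, hK, h⟩ := exists_innerForm_le (E := E) M
  refine ⟨K * (2 ^ m) ^ 2, by positivity, fun x n b hb => ?_⟩
  have hb0 : 0 ≤ b := (norm_nonneg _).trans (hb n le_rfl)
  rw [mul_assoc, ← mul_pow]
  refine h _ _ fun i => ?_
  refine pow_le_pow_left₀ (norm_nonneg _) ((norm_backDiff_le i n hb).trans ?_) 2
  exact mul_le_mul_of_nonneg_right (pow_le_pow_right₀ (by norm_num) i.2.le) hb0

theorem exists_energyA_of_matrix {k : ℕ} (hk : k = 2 ∨ k = 3 ∨ k = 4) {β : ℝ}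
    {M : Matrix (Fin k) (Fin k) ℝ} (hM : ∀ i j, M i j = M j i) (hp : PivotsPos k M)
    (hstep : ∀ e : ℕ → E, innerForm M (fun i => e i) - innerForm M (fun i => e i - e (i + 1))
      ≤ inner ℝ (∑ i ∈ Finset.range (k + 1), diffA i β • e i)
        (∑ i ∈ Finset.range k, diffC i β • e i)) :
    ∃ Q : (ℕ → E) → ℕ → ℝ, ∃ c > 0, ∃ K ≥ 0,
      (∀ x n, k ≤ n + 1 →
        Q x (n + 1) - Q x n ≤ inner ℝ (opA k β x (n + 1)) (opC k β x (n + 1))) ∧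
      (∀ x n, k ≤ n + 1 → c * ‖x n‖ ^ 2 ≤ Q x n ∧ c * ‖opC k β x n‖ ^ 2 ≤ Q x n) ∧
      (∀ x b, (∀ j ≤ k - 1, ‖x j‖ ≤ b) → Q x (k - 1) ≤ K * b ^ 2) := by
  obtain ⟨c, hc, h1⟩ := innerForm_backDiff_nonneg_bounds (E := E) (by omega) hM hp
    (fun i => diffC i β)
  obtain ⟨K, hK, h2⟩ := exists_innerForm_backDiff_le (E := E) M
  refine ⟨fun x n => innerForm M fun i => backDiff i x n, c, hc, K, hK, fun x n hn => ?_,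
    fun x n hn => ?_, fun x b hb => h2 x (k - 1) b hb⟩
  · rw [opA_eq_sum_backDiff hk β x hn, opC_eq_sum_backDiff hk β x (by omega)]
    simp only [backDiff_pred _ x n]
    exact hstep fun i => backDiff i x (n + 1)
  · rw [opC_eq_sum_backDiff hk β x hn]
    exact h1 x n

/-- The lower bound on `‖opC k β x n‖` controls the `H`-norm term of the Lipschitz condition in the
Gronwall step; the upper bound at `k - 1` is for the starting values. -/
theorem exists_energyA {k : ℕ} {β : ℝ} (h : ((k = 2 ∨ k = 3) ∧ 1 < β) ∨ (k = 4 ∧ 2 ≤ β)) :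
    ∃ Q : (ℕ → E) → ℕ → ℝ, ∃ c > 0, ∃ K ≥ 0,
      (∀ x n, k ≤ n + 1 →
        Q x (n + 1) - Q x n ≤ inner ℝ (opA k β x (n + 1)) (opC k β x (n + 1))) ∧
      (∀ x n, k ≤ n + 1 → c * ‖x n‖ ^ 2 ≤ Q x n ∧ c * ‖opC k β x n‖ ^ 2 ≤ Q x n) ∧
      (∀ x b, (∀ j ≤ k - 1, ‖x j‖ ≤ b) → Q x (k - 1) ≤ K * b ^ 2) := by
  rcases h with ⟨rfl | rfl, hβ⟩ | ⟨rfl, hβ⟩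
  · exact exists_energyA_of_matrix (by simp) (energyA_two_symm β) (energyA_two_pivotsPos hβ.le)
      (energyA_two_sub_le hβ.le)
  · exact exists_energyA_of_matrix (by simp) (energyA_three_symm β)
      (energyA_three_pivotsPos hβ.le) (energyA_three_sub_le hβ.le)
  · exact exists_energyA_of_matrix (by simp) (energyA_four_symm β) (energyA_four_pivotsPos hβ)
      (energyA_four_sub_le hβ)

theorem exists_energyB_of_matrix {m : ℕ} (hk : m + 1 = 2 ∨ m + 1 = 3 ∨ m + 1 = 4) {β d w : ℝ}
    (hd : 0 < d) (hw : 0 < w) {M : Matrix (Fin m) (Fin m) ℝ} (hM : ∀ i j, M i j = M j i)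
    (hp : PivotsPos m M)
    (hstep : ∀ e : ℕ → E, innerForm M (fun i => e i) - innerForm M (fun i => e i - e (i + 1))
      ≤ w * (d * inner ℝ (∑ i ∈ Finset.range (m + 1), diffC i (β - 1) • e i)
        (∑ i ∈ Finset.range (m + 1), diffC i β • e i)
        - (β - 1) * ‖∑ i ∈ Finset.range (m + 1), diffC i β • e i‖ ^ 2)) :
    ∃ Q : (ℕ → E) → ℕ → ℝ, ∃ K ≥ 0,
      (∀ x n, m + 1 ≤ n + 1 → Q x (n + 1) - Q x n + (β - 1) / d * ‖opC (m + 1) β x (n + 1)‖ ^ 2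
        ≤ inner ℝ (opB (m + 1) β x (n + 1)) (opC (m + 1) β x (n + 1))) ∧
      (∀ x n, 0 ≤ Q x n) ∧
      (∀ x b, (∀ j ≤ m, ‖x j‖ ≤ b) → Q x m ≤ K * b ^ 2) := by
  obtain ⟨c, hc, h1⟩ := PivotsPos.exists_coercive (E := E) m M hM hp
  obtain ⟨K, hK, h2⟩ := exists_innerForm_backDiff_le (E := E) M
  have hwd : 0 < w * d := mul_pos hw hd
  refine ⟨fun x n => (w * d)⁻¹ * innerForm M fun i => backDiff i x n, (w * d)⁻¹ * K,
    by positivity, fun x n hn => ?_, fun x n => ?_, fun x b hb => ?_⟩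
  · rw [opB_eq_sum_backDiff hk β x (by omega), opC_eq_sum_backDiff hk β x (by omega)]
    simp only [backDiff_pred _ x n]
    have h3 := hstep fun i => backDiff i x (n + 1)
    rw [← mul_sub, ← le_sub_iff_add_le, inv_mul_le_iff₀ hwd]
    refine h3.trans (le_of_eq ?_)
    field_simp
  · exact mul_nonneg (by positivity) (le_trans (by positivity) (h1 _))
  · rw [mul_assoc]
    exact mul_le_mul_of_nonneg_left (h2 x m b hb) (by positivity)

theorem exists_energyB {k : ℕ} {β : ℝ} (h : ((k = 2 ∨ k = 3) ∧ 1 < β) ∨ (k = 4 ∧ 2 ≤ β)) :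
    ∃ Q : (ℕ → E) → ℕ → ℝ, ∃ K ≥ 0,
      (∀ x n, k ≤ n + 1 → Q x (n + 1) - Q x n + eta k β * ‖opC k β x (n + 1)‖ ^ 2
        ≤ inner ℝ (opB k β x (n + 1)) (opC k β x (n + 1))) ∧
      (∀ x n, 0 ≤ Q x n) ∧
      (∀ x b, (∀ j ≤ k - 1, ‖x j‖ ≤ b) → Q x (k - 1) ≤ K * b ^ 2) := by
  rcases h with ⟨rfl | rfl, hβ⟩ | ⟨rfl, hβ⟩
  · exact exists_energyB_of_matrix (by simp) (by linarith) one_pos (energyB_two_symm β)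
      (energyB_two_pivotsPos hβ.le) fun e => by
        rw [one_mul]; exact energyB_two_sub_le hβ.le e
  · exact exists_energyB_of_matrix (by simp) (by linarith) one_pos (energyB_three_symm β)
      (energyB_three_pivotsPos hβ.le) fun e => by
        rw [one_mul]; exact energyB_three_sub_le hβ.le e
  · exact exists_energyB_of_matrix (by simp) (by linarith) (by positivity) (energyB_four_symm β)
      (energyB_four_pivotsPos hβ) (energyB_four_sub_le hβ)

theorem norm_opC_le {k : ℕ} (β : ℝ) {x : ℕ → E} {n : ℕ} {b : ℝ}
    (h : ∀ q < k, ‖x (n + 1 + q - k)‖ ≤ b) :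
    ‖opC k β x n‖ ≤ (∑ q ∈ Finset.range k, |coeffC k q β|) * b := by
  rw [opC, Finset.sum_mul]
  refine (norm_sum_le _ _).trans (Finset.sum_le_sum fun q hq => ?_)
  rw [norm_smul, Real.norm_eq_abs]
  exact mul_le_mul_of_nonneg_left (h q (Finset.mem_range.1 hq)) (abs_nonneg _)

end Energy

/-! ### Taylor polynomials and the error of exact formulas -/

section Taylor

variable {E : Type*} [NormedAddCommGroup E] [NormedSpace ℝ E]

open Set

/-- `u` is approximated by polynomials of degree less than `k`, centred at any point of `[0, T]`,
with an error of order `k` to the right of this point. -/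
def HasUniformTaylor (u : ℝ → E) (T : ℝ) (k : ℕ) (M : ℝ) : Prop :=
  ∀ t₀ ∈ Icc 0 T, ∃ p : ℕ → E, ∀ s ∈ Icc t₀ T,
    ‖u s - ∑ j ∈ Finset.range k, (s - t₀) ^ j • p j‖ ≤ M * (s - t₀) ^ k

/-- The remainder of the integrated polynomial vanishes at `t₀` and its derivative is the given
remainder, so the mean value inequality gains one power. -/
theorem norm_sub_integrated_taylor_le {u u' : ℝ → E} {T M t₀ : ℝ} {k : ℕ} {p : ℕ → E}
    (hM : 0 ≤ M)
    (hu : ∀ s ∈ Icc t₀ T, HasDerivWithinAt u (u' s) (Icc t₀ T) s)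
    (hp : ∀ s ∈ Icc t₀ T,
      ‖u' s - ∑ j ∈ Finset.range k, (s - t₀) ^ j • p j‖ ≤ M * (s - t₀) ^ k) :
    ∀ s ∈ Icc t₀ T, ‖u s - (u t₀ + ∑ j ∈ Finset.range k,
      (s - t₀) ^ (j + 1) • (((j : ℝ) + 1)⁻¹ • p j))‖ ≤ M * (s - t₀) ^ (k + 1) := by
  intro s hs
  set r : ℝ → E := fun σ => u σ - (u t₀ + ∑ j ∈ Finset.range k,
      (σ - t₀) ^ (j + 1) • (((j : ℝ) + 1)⁻¹ • p j)) with hr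
  have hsub : Icc t₀ s ⊆ Icc t₀ T := Icc_subset_Icc_right hs.2
  have hder : ∀ σ ∈ Icc t₀ s, HasDerivWithinAt r
      (u' σ - ∑ j ∈ Finset.range k, (σ - t₀) ^ j • p j) (Icc t₀ s) σ := by
    intro σ hσ
    refine ((hu σ (hsub hσ)).mono hsub).sub ?_
    refine HasDerivWithinAt.const_add _ ?_
    refine HasDerivWithinAt.fun_sum fun j _ => ?_
    have h1 : HasDerivWithinAt (fun σ : ℝ => (σ - t₀) ^ (j + 1))
        (((j + 1 : ℕ) : ℝ) * (σ - t₀) ^ j * 1) (Icc t₀ s) σ := by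
      simpa using ((hasDerivWithinAt_id σ (Icc t₀ s)).sub_const t₀).fun_pow (j + 1)
    have h2 := h1.smul_const (((j : ℝ) + 1)⁻¹ • p j)
    convert h2 using 1
    rw [smul_smul]
    congr 1
    have : (j : ℝ) + 1 ≠ 0 := by positivity
    push_cast
    field_simp
  have hb : ∀ σ ∈ Icc t₀ s, ‖u' σ - ∑ j ∈ Finset.range k, (σ - t₀) ^ j • p j‖
      ≤ M * (s - t₀) ^ k := fun σ hσ =>
    (hp σ (hsub hσ)).trans (mul_le_mul_of_nonneg_left
      (pow_le_pow_left₀ (by linarith [hσ.1]) (by linarith [hσ.2]) k) hM)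
  have hfin := (convex_Icc t₀ s).norm_image_sub_le_of_norm_hasDerivWithin_le hder hb
    (left_mem_Icc.2 hs.1) (right_mem_Icc.2 hs.1)
  have hr0 : r t₀ = 0 := by simp [hr]
  rw [hr0, sub_zero, Real.norm_eq_abs, abs_of_nonneg (by linarith [hs.1])] at hfin
  calc _ ≤ M * (s - t₀) ^ k * (s - t₀) := hfin
    _ = _ := by rw [pow_succ]; ring

theorem ContDiffOn.hasDerivWithinAt_Icc {u : ℝ → E} {T : ℝ} {k : ℕ}
    (hu : ContDiffOn ℝ (k + 1) u (Icc 0 T)) {t₀ : ℝ} (ht₀ : 0 ≤ t₀) :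
    ∀ s ∈ Icc t₀ T, HasDerivWithinAt u (derivWithin u (Icc 0 T) s) (Icc t₀ T) s := fun s hs =>
  ((hu.differentiableOn (by simp) s ⟨ht₀.trans hs.1, hs.2⟩).hasDerivWithinAt).mono
    (Icc_subset_Icc_left ht₀)

/-- Integrating an expansion of the derivative, by induction on `k`. The constant comes from a bound
on the top derivative over the compact interval, hence is uniform in the centre. -/
theorem exists_hasUniformTaylor {T : ℝ} (hT : 0 < T) : ∀ (k : ℕ) (u : ℝ → E),
    ContDiffOn ℝ k u (Icc 0 T) → ∃ M ≥ 0, HasUniformTaylor u T k M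
  | 0, u, hu => by
    obtain ⟨M, hM⟩ := isCompact_Icc.exists_bound_of_continuousOn hu.continuousOn
    refine ⟨max M 0, le_max_right _ _, fun t₀ ht₀ => ⟨0, fun s hs => ?_⟩⟩
    simpa using Or.inl (hM s ⟨ht₀.1.trans hs.1, hs.2⟩)
  | k + 1, u, hu => by
    have hu' : ContDiffOn ℝ (k + 1) u (Icc 0 T) := by exact_mod_cast hu
    obtain ⟨M, hM, h⟩ := exists_hasUniformTaylor hT k (derivWithin u (Icc 0 T))
      (hu'.derivWithin (uniqueDiffOn_Icc hT) le_rfl)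
    refine ⟨M, hM, fun t₀ ht₀ => ?_⟩
    obtain ⟨p, hp⟩ := h t₀ ht₀
    refine ⟨fun j => Nat.casesOn j (u t₀) fun j => ((j : ℝ) + 1)⁻¹ • p j, fun s hs => ?_⟩
    rw [Finset.sum_range_succ']
    have := norm_sub_integrated_taylor_le hM
      (ContDiffOn.hasDerivWithinAt_Icc hu' ht₀.1) hp s hs
    simpa [add_comm] using this

/-- Interpolation formulas that are exact for polynomials of degree less than `k` have errors of
order `k`. -/
theorem HasUniformTaylor.norm_sub_sum_le {u : ℝ → E} {T M : ℝ} {k : ℕ}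
    (hu : HasUniformTaylor u T k M) {m : ℕ} {w θ : ℕ → ℝ} {ϑ : ℝ} (hθ : ∀ q < m, 0 ≤ θ q)
    (hϑ : 0 ≤ ϑ)
    (hex : ∀ j < k, ∑ q ∈ Finset.range m, w q * θ q ^ j = ϑ ^ j) {t₀ Δt : ℝ}
    (ht₀ : 0 ≤ t₀) (hΔt : 0 ≤ Δt) (h1 : t₀ + ϑ * Δt ≤ T) (h2 : ∀ q < m, t₀ + θ q * Δt ≤ T) :
    ‖u (t₀ + ϑ * Δt) - ∑ q ∈ Finset.range m, w q • u (t₀ + θ q * Δt)‖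
      ≤ M * (ϑ ^ k + ∑ q ∈ Finset.range m, |w q| * θ q ^ k) * Δt ^ k := by
  have hϑΔ : 0 ≤ ϑ * Δt := mul_nonneg hϑ hΔt
  obtain ⟨p, hp⟩ := hu t₀ ⟨ht₀, by linarith⟩
  set P : ℝ → E := fun s => ∑ j ∈ Finset.range k, (s - t₀) ^ j • p j with hP
  have hPex : P (t₀ + ϑ * Δt) = ∑ q ∈ Finset.range m, w q • P (t₀ + θ q * Δt) := by
    simp only [hP, add_sub_cancel_left, Finset.smul_sum]
    rw [Finset.sum_comm]
    refine Finset.sum_congr rfl fun j hj => ?_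
    simp only [smul_smul, ← Finset.sum_smul]
    congr 1
    rw [mul_pow, ← hex j (Finset.mem_range.1 hj), Finset.sum_mul]
    exact Finset.sum_congr rfl fun q _ => by ring
  have hid : u (t₀ + ϑ * Δt) - ∑ q ∈ Finset.range m, w q • u (t₀ + θ q * Δt)
      = (u (t₀ + ϑ * Δt) - P (t₀ + ϑ * Δt))
        - ∑ q ∈ Finset.range m, w q • (u (t₀ + θ q * Δt) - P (t₀ + θ q * Δt)) := by
    simp only [smul_sub, Finset.sum_sub_distrib, ← hPex]
    abel
  have hb1 : ‖u (t₀ + ϑ * Δt) - P (t₀ + ϑ * Δt)‖ ≤ M * (ϑ * Δt) ^ k :=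
    (hp (t₀ + ϑ * Δt) ⟨by linarith, h1⟩).trans (by rw [add_sub_cancel_left])
  have hb2 : ∀ q ∈ Finset.range m, ‖w q • (u (t₀ + θ q * Δt) - P (t₀ + θ q * Δt))‖
      ≤ M * (|w q| * θ q ^ k) * Δt ^ k := fun q hq => by
    have hq' := Finset.mem_range.1 hq
    have := hp (t₀ + θ q * Δt) ⟨by linarith [mul_nonneg (hθ q hq') hΔt], h2 q hq'⟩
    rw [norm_smul, Real.norm_eq_abs]
    refine (mul_le_mul_of_nonneg_left this (abs_nonneg _)).trans (le_of_eq ?_)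
    rw [add_sub_cancel_left, mul_pow]
    ring
  rw [hid]
  refine (norm_sub_le _ _).trans ?_
  refine (add_le_add hb1 ((norm_sum_le _ _).trans (Finset.sum_le_sum hb2))).trans (le_of_eq ?_)
  rw [← Finset.sum_mul, ← Finset.mul_sum, mul_pow]
  ring

/-- Differentiation formulas that are exact for polynomials of degree at most `k` have errors of
order `k + 1`, after multiplication by the step size. -/
theorem exists_norm_smul_derivWithin_sub_sum_le {u : ℝ → E} {T : ℝ} (hT : 0 < T) {k : ℕ}
    (hu : ContDiffOn ℝ (k + 1) u (Icc 0 T)) {m : ℕ} {w θ : ℕ → ℝ} {ϑ : ℝ}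
    (hθ : ∀ q < m, 0 ≤ θ q) (hϑ : 0 ≤ ϑ) (hex0 : ∑ q ∈ Finset.range m, w q = 0)
    (hex : ∀ j < k, ∑ q ∈ Finset.range m, w q * θ q ^ (j + 1) = (j + 1) * ϑ ^ j) :
    ∃ K ≥ 0, ∀ t₀ Δt : ℝ, 0 ≤ t₀ → 0 ≤ Δt → t₀ + ϑ * Δt ≤ T → (∀ q < m, t₀ + θ q * Δt ≤ T) →
      ‖Δt • derivWithin u (Icc 0 T) (t₀ + ϑ * Δt)
        - ∑ q ∈ Finset.range m, w q • u (t₀ + θ q * Δt)‖ ≤ K * Δt ^ (k + 1) := by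
  obtain ⟨M, hM, h⟩ := exists_hasUniformTaylor hT k (derivWithin u (Icc 0 T))
    (hu.derivWithin (uniqueDiffOn_Icc hT) le_rfl)
  refine ⟨M * (ϑ ^ k + ∑ q ∈ Finset.range m, |w q| * θ q ^ (k + 1)), ?_,
    fun t₀ Δt ht₀ hΔt h1 h2 => ?_⟩
  · refine mul_nonneg hM (add_nonneg (by positivity) (Finset.sum_nonneg fun q hq => ?_))
    have := hθ q (Finset.mem_range.1 hq)
    positivity
  have hϑΔ : 0 ≤ ϑ * Δt := mul_nonneg hϑ hΔt
  -- The function is compared with the integral of the very polynomial that approximates its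
  -- derivative, so that exactness of the formula cancels both.
  obtain ⟨p, hp⟩ := h t₀ ⟨ht₀, by linarith⟩
  have hp' := norm_sub_integrated_taylor_le hM (ContDiffOn.hasDerivWithinAt_Icc hu ht₀) hp
  set P : ℝ → E := fun s => u t₀ + ∑ j ∈ Finset.range k,
      (s - t₀) ^ (j + 1) • (((j : ℝ) + 1)⁻¹ • p j) with hP
  set P' : ℝ → E := fun s => ∑ j ∈ Finset.range k, (s - t₀) ^ j • p j with hP'
  have hPex : Δt • P' (t₀ + ϑ * Δt) = ∑ q ∈ Finset.range m, w q • P (t₀ + θ q * Δt) := by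
    simp only [hP, hP', add_sub_cancel_left, Finset.smul_sum, smul_add, Finset.sum_add_distrib,
      ← Finset.sum_smul, hex0, zero_smul, zero_add]
    rw [Finset.sum_comm]
    refine Finset.sum_congr rfl fun j hj => ?_
    simp only [smul_smul, ← Finset.sum_smul]
    congr 1
    have hj1 : (j : ℝ) + 1 ≠ 0 := by positivity
    have : ∑ q ∈ Finset.range m, w q * ((θ q * Δt) ^ (j + 1) * ((j : ℝ) + 1)⁻¹)
        = (∑ q ∈ Finset.range m, w q * θ q ^ (j + 1)) * (Δt ^ (j + 1) * ((j : ℝ) + 1)⁻¹) := by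
      rw [Finset.sum_mul]
      exact Finset.sum_congr rfl fun q _ => by ring
    rw [this, hex j (Finset.mem_range.1 hj)]
    field_simp
    ring
  have hid : Δt • derivWithin u (Icc 0 T) (t₀ + ϑ * Δt)
        - ∑ q ∈ Finset.range m, w q • u (t₀ + θ q * Δt)
      = Δt • (derivWithin u (Icc 0 T) (t₀ + ϑ * Δt) - P' (t₀ + ϑ * Δt))
        - ∑ q ∈ Finset.range m, w q • (u (t₀ + θ q * Δt) - P (t₀ + θ q * Δt)) := by
    simp only [smul_sub, Finset.sum_sub_distrib, ← hPex]
    abel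
  have hb1 : ‖Δt • (derivWithin u (Icc 0 T) (t₀ + ϑ * Δt) - P' (t₀ + ϑ * Δt))‖
      ≤ M * ϑ ^ k * Δt ^ (k + 1) := by
    have := hp (t₀ + ϑ * Δt) ⟨by linarith, h1⟩
    rw [norm_smul, Real.norm_eq_abs, abs_of_nonneg hΔt]
    refine (mul_le_mul_of_nonneg_left this hΔt).trans (le_of_eq ?_)
    rw [add_sub_cancel_left, mul_pow]
    ring
  have hb2 : ∀ q ∈ Finset.range m, ‖w q • (u (t₀ + θ q * Δt) - P (t₀ + θ q * Δt))‖
      ≤ M * (|w q| * θ q ^ (k + 1)) * Δt ^ (k + 1) := fun q hq => by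
    have hq' := Finset.mem_range.1 hq
    have := hp' (t₀ + θ q * Δt) ⟨by linarith [mul_nonneg (hθ q hq') hΔt], h2 q hq'⟩
    rw [norm_smul, Real.norm_eq_abs]
    refine (mul_le_mul_of_nonneg_left this (abs_nonneg _)).trans (le_of_eq ?_)
    rw [add_sub_cancel_left, mul_pow]
    ring
  rw [hid]
  refine (norm_sub_le _ _).trans ?_
  refine (add_le_add hb1 ((norm_sum_le _ _).trans (Finset.sum_le_sum hb2))).trans (le_of_eq ?_)
  rw [← Finset.sum_mul, ← Finset.mul_sum]
  ring

end Taylor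

/-! ### Exactness of the formulas, with time measured from the oldest node -/

theorem coeffA_sum {k : ℕ} (hk : k = 2 ∨ k = 3 ∨ k = 4) (β : ℝ) :
    ∑ q ∈ Finset.range (k + 1), coeffA k q β = 0 := by
  rcases hk with rfl | rfl | rfl <;> norm_num [Finset.sum_range_succ, coeffA] <;> ring

theorem coeffA_sum_pow {k : ℕ} (hk : k = 2 ∨ k = 3 ∨ k = 4) (β : ℝ) {j : ℕ} (hj : j < k) :
    ∑ q ∈ Finset.range (k + 1), coeffA k q β * (q : ℝ) ^ (j + 1)
      = (j + 1) * (β + k - 1) ^ j := by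
  rcases hk with rfl | rfl | rfl <;> interval_cases j <;>
    norm_num [Finset.sum_range_succ, coeffA] <;> ring

theorem coeffB_sum_pow {k : ℕ} (hk : k = 2 ∨ k = 3 ∨ k = 4) (β : ℝ) {j : ℕ} (hj : j < k) :
    ∑ q ∈ Finset.range k, coeffB k q β * ((q : ℝ) + 1) ^ j = (β + k - 1) ^ j := by
  rcases hk with rfl | rfl | rfl <;> interval_cases j <;>
    norm_num [Finset.sum_range_succ, coeffB] <;> ring

theorem coeffC_sum_pow {k : ℕ} (hk : k = 2 ∨ k = 3 ∨ k = 4) (β : ℝ) {j : ℕ} (hj : j < k) :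
    ∑ q ∈ Finset.range k, coeffC k q β * (q : ℝ) ^ j = (β + k - 1) ^ j := by
  rcases hk with rfl | rfl | rfl <;> interval_cases j <;>
    norm_num [Finset.sum_range_succ, coeffC] <;> ring

/-! ### Truncation errors of smooth solutions -/

section TruncationErrors

variable {V H : Type*} [NormedAddCommGroup V] [InnerProductSpace ℝ V]
  [NormedAddCommGroup H] [InnerProductSpace ℝ H]

open Set

theorem truncationErrorBound_of_contDiffOn (ι : V →L[ℝ] H) {u : ℝ → V} {T T' : ℝ} (hT : 0 < T)
    (hTT' : T < T') {k : ℕ} (hk : k = 2 ∨ k = 3 ∨ k = 4) {β : ℝ} (hβ : 1 ≤ β)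
    (hu : ContDiffOn ℝ k u (Icc 0 T'))
    (hιu : ContDiffOn ℝ (k + 1) (fun s => ι (u s)) (Icc 0 T')) :
    TruncationErrorBound ι u T k β := by
  have hT' : 0 < T' := hT.trans hTT'
  have hk1 : 1 ≤ k := by omega
  have hkR : (1 : ℝ) ≤ k := by exact_mod_cast hk1
  have hϑ : 0 ≤ β + k - 1 := by linarith
  obtain ⟨K₁, hK₁, hE⟩ := exists_norm_smul_derivWithin_sub_sum_le hT' hιu (m := k + 1)
    (w := fun q => coeffA k q β) (θ := fun q => (q : ℝ)) (fun q _ => by positivity) hϑ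
    (coeffA_sum hk β) (fun j hj => coeffA_sum_pow hk β hj)
  obtain ⟨M, hM, hTay⟩ := exists_hasUniformTaylor hT' k u hu
  set K₂ := M * ((β + k - 1) ^ k + ∑ q ∈ Finset.range k, |coeffB k q β| * ((q : ℝ) + 1) ^ k)
  set K₃ := M * ((β + k - 1) ^ k + ∑ q ∈ Finset.range k, |coeffC k q β| * (q : ℝ) ^ k)
  refine ⟨K₁ ^ 2 + K₂ ^ 2 + K₃ ^ 2 + 1, by positivity, (T' - T) / (2 * β),
    div_pos (by linarith) (by linarith), fun Δt hΔ hΔτ n hn hnT => ?_⟩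
  -- Expansions are centred at `m Δt`: all nodes in use lie at or to the right of it, and `t^{n+β}`
  -- is `m Δt + (β + k - 1) Δt`.
  obtain ⟨m, rfl⟩ : ∃ m, n = m + (k - 1) := ⟨n - (k - 1), by omega⟩
  have hcast : ((m + (k - 1) : ℕ) : ℝ) = m + k - 1 := by
    rw [Nat.cast_add, Nat.cast_sub hk1]; push_cast; ring
  rw [hcast] at hnT
  have hm0 : 0 ≤ (m : ℝ) * Δt := by positivity
  have htime : (((m + (k - 1) : ℕ) : ℝ) + β) * Δt = m * Δt + (β + k - 1) * Δt := by
    rw [hcast]; ring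
  have hβΔ : β * Δt ≤ (T' - T) / 2 := by
    rw [le_div_iff₀ (by linarith)] at hΔτ; linarith
  have hlt : (m : ℝ) * Δt + (β + k - 1) * Δt < T' := by nlinarith
  have hpos : 0 < (m : ℝ) * Δt + (β + k - 1) * Δt := by
    have : 0 < (β + k - 1) * Δt := mul_pos (by linarith) hΔ
    linarith
  have hpts : ∀ q : ℕ, q ≤ k → (m : ℝ) * Δt + q * Δt ≤ T' := fun q hq => by
    have : (q : ℝ) ≤ k := by exact_mod_cast hq
    nlinarith
  have hbE : ‖truncE ι u k β Δt (m + (k - 1))‖ ≤ K₁ * Δt ^ (k + 1) := by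
    have := hE (m * Δt) Δt hm0 hΔ.le hlt.le fun q hq => hpts q (by omega)
    rw [derivWithin_of_mem_nhds (Icc_mem_nhds hpos hlt)] at this
    rw [truncE, htime, opA]
    convert this using 5 with q hq
    rw [show m + (k - 1) + 1 + q - k = m + q by omega]
    push_cast
    ring_nf
  have hbR : ‖truncR u k β Δt (m + (k - 1))‖ ≤ K₂ * Δt ^ k := by
    have := hTay.norm_sub_sum_le (m := k) (w := fun q => coeffB k q β)
      (θ := fun q => (q : ℝ) + 1) (fun q _ => by positivity) hϑ
      (fun j hj => coeffB_sum_pow hk β hj) hm0 hΔ.le hlt.le fun q hq => by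
        simpa using hpts (q + 1) hq
    rw [truncR, htime, opB]
    convert this using 5 with q hq
    rw [show m + (k - 1) + 1 + 1 + q - k = m + q + 1 by omega]
    push_cast
    ring_nf
  have hbP : ‖truncP u k β Δt (m + (k - 1))‖ ≤ K₃ * Δt ^ k := by
    have := hTay.norm_sub_sum_le (m := k) (w := fun q => coeffC k q β)
      (θ := fun q => (q : ℝ)) (fun q _ => by positivity) hϑ
      (fun j hj => coeffC_sum_pow hk β hj) hm0 hΔ.le hlt.le fun q hq => hpts q hq.le
    rw [truncP, htime, opC]
    convert this using 5 with q hq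
    rw [show m + (k - 1) + 1 + q - k = m + q by omega]
    push_cast
    ring_nf
  have hsq : ∀ {a K : ℝ} {j : ℕ}, 0 ≤ a → a ≤ K * Δt ^ j →
      K ^ 2 ≤ K₁ ^ 2 + K₂ ^ 2 + K₃ ^ 2 + 1 →
      a ^ 2 ≤ (K₁ ^ 2 + K₂ ^ 2 + K₃ ^ 2 + 1) * Δt ^ (2 * j) := by
    intro a K j ha h h'
    calc a ^ 2 ≤ (K * Δt ^ j) ^ 2 := pow_le_pow_left₀ ha h 2
      _ = K ^ 2 * Δt ^ (2 * j) := by rw [mul_pow, ← pow_mul, mul_comm j]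
      _ ≤ _ := mul_le_mul_of_nonneg_right h' (by positivity)
  refine ⟨?_, hsq (norm_nonneg _) hbR ?_, hsq (norm_nonneg _) hbP ?_⟩
  · rw [show 2 * k + 2 = 2 * (k + 1) by ring]
    exact hsq (norm_nonneg _) hbE (by nlinarith [sq_nonneg K₂, sq_nonneg K₃])
  · nlinarith [sq_nonneg K₁, sq_nonneg K₃]
  · nlinarith [sq_nonneg K₁, sq_nonneg K₂]

end TruncationErrors

/-! ### Linearity of the difference operators -/

section Linearity

variable {E F : Type*} [NormedAddCommGroup E] [NormedSpace ℝ E] [NormedAddCommGroup F]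
  [NormedSpace ℝ F]

theorem opA_sub (k : ℕ) (β : ℝ) (x y : ℕ → E) (n : ℕ) :
    opA k β (fun j => x j - y j) n = opA k β x n - opA k β y n := by
  simp [opA, smul_sub]

theorem opB_sub (k : ℕ) (β : ℝ) (x y : ℕ → E) (n : ℕ) :
    opB k β (fun j => x j - y j) n = opB k β x n - opB k β y n := by
  simp [opB, smul_sub]

theorem opC_sub (k : ℕ) (β : ℝ) (x y : ℕ → E) (n : ℕ) :
    opC k β (fun j => x j - y j) n = opC k β x n - opC k β y n := by
  simp [opC, smul_sub]

theorem map_opA (f : E →L[ℝ] F) (k : ℕ) (β : ℝ) (x : ℕ → E) (n : ℕ) :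
    f (opA k β x n) = opA k β (fun j => f (x j)) n := by
  simp [opA]

theorem map_opC (f : E →L[ℝ] F) (k : ℕ) (β : ℝ) (x : ℕ → E) (n : ℕ) :
    f (opC k β x n) = opC k β (fun j => f (x j)) n := by
  simp [opC]

theorem opC_const {k : ℕ} (hk : k = 2 ∨ k = 3 ∨ k = 4) (β : ℝ) (w : E) (n : ℕ) :
    opC k β (fun _ => w) n = w := by
  have h := coeffC_sum_pow hk β (j := 0) (by omega)
  simp only [pow_zero, mul_one] at h
  rw [opC, ← Finset.sum_smul, h, one_smul]

end Linearity

/-! ### Gronwall inequality and the scalar energy step -/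

theorem le_sqrt_mul_of_sq_le {a K b : ℝ} (hK : 0 ≤ K) (hb : 0 ≤ b) (h : a ^ 2 ≤ K * b ^ 2) :
    a ≤ √K * b := by
  have := Real.le_sqrt_of_sq_le h
  rwa [Real.sqrt_mul hK, Real.sqrt_sq hb] at this

/-- A discrete Gronwall inequality, where the recursion is only known as long as the bound holds. -/
theorem discrete_gronwall_of_bound {S : ℕ → ℝ} {n₀ : ℕ} {a b s₀ Δt T : ℝ} (ha : 0 ≤ a)
    (hb : 0 ≤ b) (hs₀ : 0 ≤ s₀) (hΔt : 0 ≤ Δt) (h0 : S n₀ ≤ s₀)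
    (hstep : ∀ n, n₀ ≤ n → (n + 1) * Δt ≤ T → S n ≤ Real.exp (a * T) * (s₀ + b * T) →
      S (n + 1) ≤ (1 + a * Δt) * S n + b * Δt) (n : ℕ) (hn : n₀ ≤ n) (hnT : n * Δt ≤ T) :
    S n ≤ Real.exp (a * T) * (s₀ + b * T) := by
  have hmono : ∀ t, 0 ≤ t → t ≤ T →
      Real.exp (a * t) * (s₀ + b * t) ≤ Real.exp (a * T) * (s₀ + b * T) := fun t ht htT =>
    mul_le_mul (Real.exp_le_exp.2 (by gcongr)) (by gcongr) (by positivity) (Real.exp_nonneg _)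
  suffices h : S n ≤ Real.exp (a * (n * Δt)) * (s₀ + b * (n * Δt)) from
    h.trans (hmono _ (by positivity) hnT)
  induction n, hn using Nat.le_induction with
  | base =>
    refine h0.trans ?_
    have h1 : 1 ≤ Real.exp (a * (n₀ * Δt)) := Real.one_le_exp (by positivity)
    have h2 : 0 ≤ b * (n₀ * Δt) := by positivity
    nlinarith
  | succ n hn ih =>
    push_cast at hnT ⊢
    have hnT' : n * Δt ≤ T := by nlinarith
    have hS := ih hnT'
    have h1 := hstep n hn hnT (hS.trans (hmono _ (by positivity) hnT'))
    have h2 : 1 + a * Δt ≤ Real.exp (a * Δt) := by linarith [Real.add_one_le_exp (a * Δt)]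
    have h3 : Real.exp (a * ((n + 1) * Δt)) = Real.exp (a * Δt) * Real.exp (a * (n * Δt)) := by
      rw [← Real.exp_add]; ring_nf
    have h4 : 1 ≤ Real.exp (a * ((n + 1) * Δt)) := Real.one_le_exp (by positivity)
    have h5 : 0 ≤ Real.exp (a * (n * Δt)) * (s₀ + b * (n * Δt)) := by positivity
    calc S (n + 1) ≤ (1 + a * Δt) * S n + b * Δt := h1
      _ ≤ (1 + a * Δt) * (Real.exp (a * (n * Δt)) * (s₀ + b * (n * Δt))) + b * Δt := by gcongr
      _ ≤ Real.exp (a * Δt) * (Real.exp (a * (n * Δt)) * (s₀ + b * (n * Δt))) + b * Δt := by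
          gcongr
      _ ≤ Real.exp (a * ((n + 1) * Δt)) * (s₀ + b * (n * Δt))
          + Real.exp (a * ((n + 1) * Δt)) * (b * Δt) := by
          rw [h3, mul_assoc]
          rw [h3] at h4
          have : 0 ≤ b * Δt := by positivity
          nlinarith
      _ = _ := by ring

/-- Budget for `η x'² ≥ (g + ρ) x'²`: one `g / 2` pays for the product `g x x'`, the other is stored
in the new energy to cancel `g / 2 x²` at the next step; one `ρ / 2` pays for `m z + d` by Young's
inequality, the other is the dissipation kept in the estimate. -/
theorem energy_step {qA qA' qB qB' x x' z g m d η ρ Δt : ℝ} (hΔt : 0 ≤ Δt) (hρ : 0 < ρ)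
    (hg : 0 ≤ g) (hη : g + ρ ≤ η)
    (h : qA' - qA + Δt * (qB' - qB + η * x' ^ 2) ≤ Δt * (x' * (g * x + m * z + d))) :
    qA' + Δt * qB' + Δt * (g / 2) * x' ^ 2 + ρ / 2 * Δt * x' ^ 2
      ≤ qA + Δt * qB + Δt * (g / 2) * x ^ 2 + Δt / ρ * (m ^ 2 * z ^ 2 + d ^ 2) := by
  have h1 : x' * (g * x) ≤ g / 2 * (x ^ 2 + x' ^ 2) := by
    nlinarith [mul_nonneg hg (sq_nonneg (x - x'))]
  have h2 : x' * (m * z + d) ≤ ρ / 2 * x' ^ 2 + (m ^ 2 * z ^ 2 + d ^ 2) / ρ := by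
    have : x' * (m * z + d) * ρ ≤ ρ / 2 * x' ^ 2 * ρ + (m ^ 2 * z ^ 2 + d ^ 2) := by
      nlinarith [sq_nonneg (ρ * x' - (m * z + d)), sq_nonneg (m * z - d)]
    have h3 : x' * (m * z + d) ≤ (ρ / 2 * x' ^ 2 * ρ + (m ^ 2 * z ^ 2 + d ^ 2)) / ρ := by
      rwa [le_div_iff₀ hρ]
    rwa [add_div, mul_div_cancel_right₀ _ hρ.ne'] at h3
  have h4 : (g + ρ) * x' ^ 2 ≤ η * x' ^ 2 := mul_le_mul_of_nonneg_right hη (sq_nonneg _)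
  have h5 : qB' + g / 2 * x' ^ 2 + ρ / 2 * x' ^ 2 - (qB + g / 2 * x ^ 2)
      - (m ^ 2 * z ^ 2 + d ^ 2) / ρ ≤ qB' - qB + η * x' ^ 2 - x' * (g * x + m * z + d) := by
    nlinarith
  have h6 := mul_le_mul_of_nonneg_left h5 hΔt
  have h7 : Δt / ρ * (m ^ 2 * z ^ 2 + d ^ 2) = Δt * ((m ^ 2 * z ^ 2 + d ^ 2) / ρ) := by ring
  rw [h7]
  nlinarith

/-! ### The error equation -/

section Problem

variable {V H : Type*} [NormedAddCommGroup V] [InnerProductSpace ℝ V]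
  [NormedAddCommGroup H] [InnerProductSpace ℝ H]

theorem toDual_apply (ι : V →L[ℝ] H) (h : H) (v : V) : toDual ι h v = inner ℝ h (ι v) := rfl

/-- Polarization: `L` is the Riesz map of `V`. -/
theorem apply_apply_eq_inner {L : V →ₗ[ℝ] StrongDual ℝ V} (hs : ∀ v w : V, L v w = L w v)
    (hL : ∀ v : V, L v v = ‖v‖ ^ 2) (v w : V) : L v w = inner ℝ v w := by
  have h := hL (v + w)
  rw [norm_add_sq_real, ← hL v, ← hL w] at h
  simp only [map_add, add_apply] at h
  rw [hs w v] at h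
  linarith

theorem LocalLipschitz.norm_sub_le {ι : V →L[ℝ] H} {G : V → StrongDual ℝ V} {T : ℝ} {u : ℝ → V}
    {γ μ : ℝ} (h : LocalLipschitz ι G T u γ μ) (hγ : 0 ≤ γ) {t : ℝ} (ht : t ∈ Set.Icc 0 T)
    {v w : V} (hv : v ∈ Metric.closedBall (u t) 1) (hw : w ∈ Metric.closedBall (u t) 1) :
    ‖G v - G w‖ ≤ √γ * ‖v - w‖ + √(max μ 0) * ‖ι (v - w)‖ := by
  refine (le_abs_self _).trans (abs_le_of_sq_le_sq ?_ (by positivity))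
  refine (h t ht v hv w hw).trans ?_
  have h1 : μ * ‖ι (v - w)‖ ^ 2 ≤ max μ 0 * ‖ι (v - w)‖ ^ 2 :=
    mul_le_mul_of_nonneg_right (le_max_left _ _) (sq_nonneg _)
  have h2 : 0 ≤ √γ * ‖v - w‖ * (√(max μ 0) * ‖ι (v - w)‖) := by positivity
  calc γ * ‖v - w‖ ^ 2 + μ * ‖ι (v - w)‖ ^ 2
      ≤ √γ ^ 2 * ‖v - w‖ ^ 2 + √(max μ 0) ^ 2 * ‖ι (v - w)‖ ^ 2 := by
        rw [Real.sq_sqrt hγ, Real.sq_sqrt (le_max_right _ _)]; linarith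
    _ ≤ _ := by nlinarith

/-- `Δt` times the scheme minus the equation at `t^{n+β}`, tested with `v`. Expressing `u_t` and
`u(t^{n+β})` by the nodal values of `u` produces the truncation errors. -/
theorem SolvesScheme.error_equation {ι : V →L[ℝ] H} {L : V →ₗ[ℝ] StrongDual ℝ V}
    {G : V → StrongDual ℝ V} {f : ℝ → StrongDual ℝ V} {T T' : ℝ} {u : ℝ → V} {k : ℕ}
    {β Δt : ℝ} {φ : ℕ → V} (hφ : SolvesScheme ι L G f T k β Δt φ)
    (hL : ∀ v w : V, L v w = inner ℝ v w) (hu : IsSolution ι L G f T' u) (hΔt : 0 < Δt) {n : ℕ}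
    (hn : k ≤ n + 1) (hnT : (n + 1) * Δt ≤ T) (ht : (n + β) * Δt ∈ Set.Ioo 0 T') (v : V) :
    inner ℝ (opA k β (fun j : ℕ => ι (φ j - u (j * Δt))) (n + 1)) (ι v)
        + Δt * inner ℝ (opB k β (fun j : ℕ => φ j - u (j * Δt)) (n + 1)) v
      = inner ℝ (truncE ι u k β Δt n) (ι v) + Δt * inner ℝ (truncR u k β Δt n) v
        - Δt * (G (opC k β φ n) - G (u ((n + β) * Δt))) v := by
  have h1 := congrArg (fun F : StrongDual ℝ V => F v) (hφ n hn hnT)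
  have h2 := congrArg (fun F : StrongDual ℝ V => F v) (hu.equation _ ht)
  simp only [add_apply, smul_apply, toDual_apply, hL,
    smul_eq_mul, map_opA] at h1 h2
  have h3 : Δt * (1 / Δt) = 1 := by field_simp
  simp only [map_sub, opA_sub, opB_sub, truncE, truncR, inner_sub_left, real_inner_smul_left,
    sub_apply]
  linear_combination Δt * (h1 - h2)
    - h3 * inner ℝ (opA k β (fun j => ι (φ j)) (n + 1)) (ι v)

end Problem

/-! ### Bootstrap and convergence -/

section Convergence

variable {V H : Type*} [NormedAddCommGroup V] [InnerProductSpace ℝ V]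
  [NormedAddCommGroup H] [InnerProductSpace ℝ H]

open Set

/-- The extrapolation of a uniformly continuous function is close to its value. -/
theorem norm_opC_sub_le_of_uniform {u : ℝ → V} {T' δ ε : ℝ} {k : ℕ}
    (hk : k = 2 ∨ k = 3 ∨ k = 4) {β : ℝ} (hβ : 1 ≤ β)
    (hu : ∀ s ∈ Icc 0 T', ∀ t ∈ Icc 0 T', |s - t| ≤ δ → ‖u s - u t‖ ≤ ε) {Δt : ℝ}
    (hΔt : 0 < Δt) (hδ : (k + β) * Δt ≤ δ) {n : ℕ} (hn : k ≤ n + 1) (hT : (n + β) * Δt ≤ T') :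
    ‖opC k β (fun j : ℕ => u (j * Δt)) n - u ((n + β) * Δt)‖
      ≤ (∑ q ∈ Finset.range k, |coeffC k q β|) * ε := by
  rw [← opC_const hk β (u ((n + β) * Δt)) n, ← opC_sub]
  refine norm_opC_le β fun q hq => ?_
  have h1 : ((n + 1 + q - k : ℕ) : ℝ) = n + 1 + q - k := by
    rw [Nat.cast_sub (by omega)]; push_cast; ring
  have h2 : (q : ℝ) + 1 ≤ k := by exact_mod_cast hq
  have h3 : (0 : ℝ) ≤ q := by positivity
  have h4 : ((n + 1 + q - k : ℕ) : ℝ) ≤ n + β := by rw [h1]; linarith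
  refine hu _ ⟨by positivity, le_trans (by gcongr) hT⟩ _ ⟨by positivity, hT⟩ ?_
  rw [← sub_mul, abs_mul, abs_of_pos hΔt]
  refine le_trans (mul_le_mul_of_nonneg_right ?_ hΔt.le) hδ
  rw [abs_le]
  constructor <;> rw [h1] <;> linarith

/-- The energy inequality of one step of the scheme. -/
theorem SolvesScheme.energy_le {ι : V →L[ℝ] H} {L : V →ₗ[ℝ] StrongDual ℝ V}
    {G : V → StrongDual ℝ V} {f : ℝ → StrongDual ℝ V} {T T' : ℝ} {u : ℝ → V} {k : ℕ}
    {β Δt : ℝ} {φ : ℕ → V} (hφ : SolvesScheme ι L G f T k β Δt φ)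
    (hL : ∀ v w : V, L v w = inner ℝ v w) (hu : IsSolution ι L G f T' u) {γ μ : ℝ} (hγ : 0 ≤ γ)
    (hG : LocalLipschitz ι G T u γ μ) (hΔt : 0 < Δt) {n : ℕ} (hn : k ≤ n + 1)
    (hnT : (n + 1) * Δt ≤ T) (ht : (n + β) * Δt ∈ Ioo 0 T') {K : ℝ} (hK : 0 ≤ K)
    (hE : ‖truncE ι u k β Δt n‖ ^ 2 ≤ K * Δt ^ (2 * k + 2))
    (hR : ‖truncR u k β Δt n‖ ^ 2 ≤ K * Δt ^ (2 * k))
    (hP : ‖truncP u k β Δt n‖ ^ 2 ≤ K * Δt ^ (2 * k))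
    (hmem : opC k β φ n ∈ Metric.closedBall (u (n * Δt)) 1)
    (hmem' : u ((n + β) * Δt) ∈ Metric.closedBall (u (n * Δt)) 1) :
    inner ℝ (opA k β (fun j : ℕ => ι (φ j - u (j * Δt))) (n + 1))
        (opC k β (fun j : ℕ => ι (φ j - u (j * Δt))) (n + 1))
      + Δt * inner ℝ (opB k β (fun j : ℕ => φ j - u (j * Δt)) (n + 1))
        (opC k β (fun j : ℕ => φ j - u (j * Δt)) (n + 1))
      ≤ Δt * (‖opC k β (fun j : ℕ => φ j - u (j * Δt)) (n + 1)‖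
        * (√γ * ‖opC k β (fun j : ℕ => φ j - u (j * Δt)) n‖
          + √(max μ 0) * ‖opC k β (fun j : ℕ => ι (φ j - u (j * Δt))) n‖
          + (‖ι‖ + 1 + √γ + √(max μ 0) * ‖ι‖) * √K * Δt ^ k)) := by
  have hrE : ‖truncE ι u k β Δt n‖ ≤ √K * Δt ^ (k + 1) :=
    le_sqrt_mul_of_sq_le hK (by positivity) (by rw [← pow_mul]; convert hE using 3; ring)
  have hrR : ‖truncR u k β Δt n‖ ≤ √K * Δt ^ k :=
    le_sqrt_mul_of_sq_le hK (by positivity) (by rw [← pow_mul, mul_comm k]; exact hR)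
  have hrP : ‖truncP u k β Δt n‖ ≤ √K * Δt ^ k :=
    le_sqrt_mul_of_sq_le hK (by positivity) (by rw [← pow_mul, mul_comm k]; exact hP)
  rw [← map_opC ι k β (fun j : ℕ => φ j - u (j * Δt)) (n + 1),
    hφ.error_equation hL hu hΔt hn hnT ht]
  have hdiff : opC k β φ n - u ((n + β) * Δt)
      = opC k β (fun j : ℕ => φ j - u (j * Δt)) n - truncP u k β Δt n := by
    rw [opC_sub, truncP]; abel
  rw [← map_opC ι k β (fun j : ℕ => φ j - u (j * Δt)) n]
  set v := opC k β (fun j : ℕ => φ j - u (j * Δt)) (n + 1)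
  set w := opC k β (fun j : ℕ => φ j - u (j * Δt)) n
  set r := √K * Δt ^ k with hr
  have hr0 : 0 ≤ r := by positivity
  -- The ball is centred at `u(t^n)`, because `t^{n+β}` may lie beyond `T`, where the Lipschitz
  -- condition is not available.
  have hGv := hG.norm_sub_le hγ ⟨by positivity, by linarith⟩ hmem hmem'
  rw [hdiff] at hGv
  have h1 : ‖w - truncP u k β Δt n‖ ≤ ‖w‖ + r := (norm_sub_le _ _).trans (by linarith)
  have h2 : ‖ι (w - truncP u k β Δt n)‖ ≤ ‖ι w‖ + ‖ι‖ * r := by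
    rw [map_sub]
    refine (norm_sub_le _ _).trans ?_
    have := (ι.le_opNorm (truncP u k β Δt n)).trans
      (mul_le_mul_of_nonneg_left hrP (norm_nonneg _))
    linarith
  have h3 : ‖G (opC k β φ n) - G (u ((n + β) * Δt))‖
      ≤ √γ * (‖w‖ + r) + √(max μ 0) * (‖ι w‖ + ‖ι‖ * r) :=
    hGv.trans (add_le_add (mul_le_mul_of_nonneg_left h1 (Real.sqrt_nonneg _))
      (mul_le_mul_of_nonneg_left h2 (Real.sqrt_nonneg _)))
  -- One of the `k + 1` powers of `Δt` is set aside as the common factor, and the embedding turns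
  -- `‖ι v‖` into `‖v‖`.
  have t1 : inner ℝ (truncE ι u k β Δt n) (ι v) ≤ Δt * (‖v‖ * (‖ι‖ * r)) := by
    refine (real_inner_le_norm _ _).trans ?_
    calc ‖truncE ι u k β Δt n‖ * ‖ι v‖ ≤ (√K * Δt ^ (k + 1)) * (‖ι‖ * ‖v‖) :=
          mul_le_mul hrE (ι.le_opNorm v) (norm_nonneg _) (by positivity)
      _ = _ := by rw [hr, pow_succ]; ring
  have t2 : inner ℝ (truncR u k β Δt n) v ≤ ‖v‖ * r := by
    refine (real_inner_le_norm _ _).trans ?_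
    rw [mul_comm]
    exact mul_le_mul_of_nonneg_left hrR (norm_nonneg _)
  have t3 : -((G (opC k β φ n) - G (u ((n + β) * Δt))) v)
      ≤ ‖v‖ * (√γ * (‖w‖ + r) + √(max μ 0) * (‖ι w‖ + ‖ι‖ * r)) := by
    refine (neg_le_abs _).trans ?_
    rw [← Real.norm_eq_abs, mul_comm ‖v‖]
    exact (ContinuousLinearMap.le_opNorm _ _).trans
      (mul_le_mul_of_nonneg_right h3 (norm_nonneg _))
  have t2' := mul_le_mul_of_nonneg_left t2 hΔt.le
  have t3' := mul_le_mul_of_nonneg_left t3 hΔt.le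
  have hrK : (‖ι‖ + 1 + √γ + √(max μ 0) * ‖ι‖) * √K * Δt ^ k
      = (‖ι‖ + 1 + √γ + √(max μ 0) * ‖ι‖) * r := by rw [hr]; ring
  rw [hrK]
  linarith

set_option maxHeartbeats 1000000 in
theorem error_estimate {ι : V →L[ℝ] H} {L : V →ₗ[ℝ] StrongDual ℝ V}
    (hL : ∀ v w : V, L v w = inner ℝ v w) {G : V → StrongDual ℝ V} {f : ℝ → StrongDual ℝ V}
    {T T' : ℝ} (hT : 0 < T) (hTT' : T < T') {u : ℝ → V} (hu : IsSolution ι L G f T' u)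
    {γ μ : ℝ} (hγ : 0 ≤ γ) (hG : LocalLipschitz ι G T u γ μ) {k : ℕ} {β : ℝ}
    (hkβ : ((k = 2 ∨ k = 3) ∧ 1 < β) ∨ (k = 4 ∧ 2 ≤ β)) {ρ : ℝ} (hρ : 0 < ρ)
    (hη : ρ ≤ eta k β - √γ) (hTE : TruncationErrorBound ι u T k β) (C₀ : ℝ) :
    ∃ C > 0, ∃ τ > 0, C * τ < 1 ∧ ∀ Δt : ℝ, 0 < Δt → Δt ≤ τ → ∀ φ : ℕ → V,
      InitialSteps ι u k β Δt C₀ φ → SolvesScheme ι L G f T k β Δt φ →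
      ∀ n : ℕ, (n + 1) * Δt ≤ T →
        (k ≤ n + 2 → opC k β φ (n + 1) ∈ Metric.closedBall (u ((n + 1 + β) * Δt)) 1) ∧
        ‖ι (φ (n + 1) - u (((n + 1 : ℕ) : ℝ) * Δt))‖ ^ 2
          + ρ / 2 * Δt * ∑ q ∈ Finset.Icc (k - 1) (n + 1),
              ‖opC k β (fun j : ℕ => φ j - u (j * Δt)) q‖ ^ 2
          ≤ C * Δt ^ (2 * k) := by
  have hk : k = 2 ∨ k = 3 ∨ k = 4 := by omega
  have hβ : 1 < β := by rcases hkβ with h | h <;> linarith [h.2]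
  obtain ⟨QA, cA, hcA, KA, hKA, hA1, hA2, hA3⟩ := exists_energyA (E := H) hkβ
  obtain ⟨QB, KB, hKB, hB1, hB2, hB3⟩ := exists_energyB (E := V) hkβ
  obtain ⟨K, hK, τ₀, hτ₀, hTE⟩ := hTE
  set g := √γ with hg
  set m := √(max μ 0) with hm
  set K₁ := (‖ι‖ + 1 + g + m * ‖ι‖) * √K with hK₁
  set cC := ∑ q ∈ Finset.range k, |coeffC k q β| with hcC
  have hcC0 : 0 ≤ cC := Finset.sum_nonneg fun _ _ => abs_nonneg _
  set M₀ := max C₀ 0 with hM₀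
  have hM₀0 : 0 ≤ M₀ := le_max_right _ _
  have hg0 : 0 ≤ g := Real.sqrt_nonneg _
  set a := m ^ 2 / (ρ * cA) with ha
  set b := K₁ ^ 2 / ρ with hb
  set s := (KA + KB + (g / 2 + ρ / 2) * cC ^ 2) * M₀ with hs
  have ha0 : 0 ≤ a := by positivity
  have hb0 : 0 ≤ b := by positivity
  have hs0 : 0 ≤ s := by positivity
  set F := Real.exp (a * T) * (s + b * T) with hF
  have hF0 : 0 ≤ F := by positivity
  -- `cA⁻¹ F` bounds the error in `H`, `F` the sum of dissipation terms, and `M₀` the starting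
  -- values; the last `1` ensures positivity.
  set C := (cA⁻¹ + 1) * F + M₀ + 1 with hC
  have hC0 : 0 < C := by positivity
  obtain ⟨δ, hδ, hunif⟩ : ∃ δ > 0, ∀ s ∈ Icc 0 T', ∀ t ∈ Icc 0 T', |s - t| ≤ δ →
      ‖u s - u t‖ ≤ 1 / (4 * (cC + 1)) := by
    have h := isCompact_Icc.uniformContinuousOn_of_continuous hu.continuousOn
    rw [Metric.uniformContinuousOn_iff_le] at h
    obtain ⟨δ, hδ, h⟩ := h (1 / (4 * (cC + 1))) (by positivity)
    exact ⟨δ, hδ, fun s hs t ht hst => by simpa [dist_eq_norm] using h s hs t ht hst⟩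
  have hε : 1 / (4 * (cC + 1)) ≤ 1 / 4 := by
    rw [div_le_div_iff₀ (by positivity) (by positivity)]; linarith
  have hcε : cC * (1 / (4 * (cC + 1))) ≤ 1 / 4 := by
    rw [mul_one_div, div_le_div_iff₀ (by positivity) (by positivity)]; linarith
  -- In order: powers of `Δt` decrease; the truncation bounds hold; `t^{n+β} < T'`; all nodes are
  -- within `δ` of `t^{n+β}`; `‖C e^n‖ ≤ 1/4`; and `C τ ≤ 1/2`.
  obtain ⟨τ, hτ, h1τ, h2τ, h3τ, h4τ, h5τ, h6τ⟩ : ∃ τ > 0, τ ≤ 1 ∧ τ ≤ τ₀ ∧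
      τ ≤ (T' - T) / (2 * β) ∧ τ ≤ δ / (k + β) ∧ τ ≤ ρ / (32 * (F + 1)) ∧ τ ≤ 1 / (2 * C) := by
    refine ⟨min 1 (min τ₀ (min ((T' - T) / (2 * β)) (min (δ / (k + β))
      (min (ρ / (32 * (F + 1))) (1 / (2 * C)))))), ?_, ?_⟩
    · have : 0 < (T' - T) / (2 * β) := div_pos (by linarith) (by linarith)
      have : 0 < δ / (k + β) := div_pos hδ (by positivity)
      simp only [gt_iff_lt, lt_min_iff]
      refine ⟨one_pos, hτ₀, by assumption, by assumption, by positivity, by positivity⟩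
    · simp
  refine ⟨C, hC0, τ, hτ, ?_, fun Δt hΔ hΔτ φ hinit hφ n hnT => ?_⟩
  · have := mul_le_mul_of_nonneg_left h6τ hC0.le
    have h : C * (1 / (2 * C)) = 1 / 2 := by field_simp
    linarith
  have hΔ1 : Δt ≤ 1 := hΔτ.trans h1τ
  have hβΔ : β * Δt ≤ (T' - T) / 2 := by
    have := hΔτ.trans h3τ
    rw [le_div_iff₀ (by linarith)] at this
    linarith
  have hδΔ : (k + β) * Δt ≤ δ := by
    have := hΔτ.trans h4τ
    rw [le_div_iff₀ (by positivity)] at this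
    linarith
  have hFΔ : F * Δt ≤ ρ / 32 := by
    have := hΔτ.trans h5τ
    rw [le_div_iff₀ (by positivity)] at this
    linarith
  have hpow : Δt ^ (2 * k) ≤ Δt ^ 2 := pow_le_pow_of_le_one hΔ.le hΔ1 (by omega)
  have hD0 : 0 ≤ Δt ^ (2 * k) := by positivity
  set e : ℕ → V := fun j => φ j - u (j * Δt) with he
  -- Both energies, the stored half of the product term, and the accumulated dissipation. The
  -- `V`-energy carries a factor `Δt`, since the error equation is multiplied by `Δt`.
  set S : ℕ → ℝ := fun n => QA (fun j => ι (e j)) n + Δt * QB e n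
    + Δt * (g / 2) * ‖opC k β e n‖ ^ 2
    + ρ / 2 * Δt * ∑ q ∈ Finset.Icc (k - 1) n, ‖opC k β e q‖ ^ 2 with hS
  have hsum0 : ∀ n, 0 ≤ ∑ q ∈ Finset.Icc (k - 1) n, ‖opC k β e q‖ ^ 2 := fun n =>
    Finset.sum_nonneg fun _ _ => sq_nonneg _
  have hQA0 : ∀ n, k ≤ n + 1 → 0 ≤ QA (fun j => ι (e j)) n := fun n hn =>
    le_trans (by positivity) (hA2 (fun j => ι (e j)) n hn).1
  have hQS : ∀ n, QA (fun j => ι (e j)) n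
      + ρ / 2 * Δt * ∑ q ∈ Finset.Icc (k - 1) n, ‖opC k β e q‖ ^ 2 ≤ S n := fun n => by
    have h1 : 0 ≤ Δt * QB e n := mul_nonneg hΔ.le (hB2 e n)
    have h2 : 0 ≤ Δt * (g / 2) * ‖opC k β e n‖ ^ 2 := by positivity
    simp only [hS]; linarith
  have htime : ∀ n : ℕ, n * Δt ≤ T → (n + β) * Δt ∈ Ioo 0 T' := fun n hn =>
    ⟨by positivity, by rw [add_mul]; linarith⟩
  -- The bound on `S n` controls `Δt ‖C e^n‖²` by `Δt^{2k}`, which leaves a positive power of `Δt`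
  -- and gives `1/4`; extrapolating `u` itself costs another `1/4`.
  have hclose : ∀ n : ℕ, k ≤ n + 1 → n * Δt ≤ T → S n ≤ F * Δt ^ (2 * k) →
      ‖opC k β φ n - u ((n + β) * Δt)‖ ≤ 1 / 2 := by
    intro n hn hnT hSn
    have h1 := norm_opC_sub_le_of_uniform hk hβ.le hunif hΔ hδΔ hn (htime n hnT).2.le
    have h2 : ‖opC k β e n‖ ≤ 1 / 4 := by
      have h3 : ‖opC k β e n‖ ^ 2 ≤ ∑ q ∈ Finset.Icc (k - 1) n, ‖opC k β e q‖ ^ 2 :=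
        Finset.single_le_sum (f := fun q => ‖opC k β e q‖ ^ 2) (fun _ _ => sq_nonneg _)
          (Finset.mem_Icc.2 ⟨by omega, le_rfl⟩)
      have h4 : ρ / 2 * Δt * ‖opC k β e n‖ ^ 2 ≤ F * Δt ^ 2 := by
        have h5 := mul_le_mul_of_nonneg_left h3 (by positivity : 0 ≤ ρ / 2 * Δt)
        have h6 := mul_le_mul_of_nonneg_left hpow hF0
        linarith [hQS n, hQA0 n hn]
      have h5 : ρ / 2 * ‖opC k β e n‖ ^ 2 ≤ F * Δt := by
        refine le_of_mul_le_mul_left ?_ hΔ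
        linarith
      have h6 : ‖opC k β e n‖ ^ 2 ≤ (1 / 4) ^ 2 := by
        refine le_of_mul_le_mul_left ?_ (by positivity : 0 < ρ / 2)
        linarith
      exact le_of_sq_le_sq h6 (by norm_num)
    have h3 : opC k β φ n - u ((n + β) * Δt)
        = opC k β e n + (opC k β (fun j : ℕ => u (j * Δt)) n - u ((n + β) * Δt)) := by
      rw [he, opC_sub]; abel
    rw [h3]
    refine (norm_add_le _ _).trans ?_
    linarith
  have hinitV : ∀ j ≤ k - 1, ‖e j‖ ≤ √M₀ * Δt ^ k := fun j hj => by
    rcases Nat.eq_zero_or_pos j with rfl | hj0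
    · simp only [he, hinit.zero, Nat.cast_zero, zero_mul, sub_self, norm_zero]
      positivity
    · refine le_sqrt_mul_of_sq_le hM₀0 (by positivity) ?_
      rw [← pow_mul, mul_comm k]
      exact (hinit.accurate j hj0 hj).2.trans
        (mul_le_mul_of_nonneg_right (le_max_left _ _) hD0)
  have hinitH : ∀ j ≤ k - 1, ‖ι (e j)‖ ≤ √M₀ * Δt ^ k := fun j hj => by
    rcases Nat.eq_zero_or_pos j with rfl | hj0
    · simp only [he, hinit.zero, Nat.cast_zero, zero_mul, sub_self, map_zero, norm_zero]
      positivity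
    · refine le_sqrt_mul_of_sq_le hM₀0 (by positivity) ?_
      rw [← pow_mul, mul_comm k]
      exact (hinit.accurate j hj0 hj).1.trans
        (mul_le_mul_of_nonneg_right (le_max_left _ _) hD0)
  have hsqM : (√M₀ * Δt ^ k) ^ 2 = M₀ * Δt ^ (2 * k) := by
    rw [mul_pow, Real.sq_sqrt hM₀0, ← pow_mul, mul_comm k]
  -- At `k - 1` the sum has a single term, and `Δt ≤ 1` drops the factors `Δt`.
  have hS0 : S (k - 1) ≤ s * Δt ^ (2 * k) := by
    have h1 := hA3 (fun j => ι (e j)) _ hinitH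
    have h2 := hB3 e _ hinitV
    have h3 : ‖opC k β e (k - 1)‖ ^ 2 ≤ (cC * (√M₀ * Δt ^ k)) ^ 2 :=
      pow_le_pow_left₀ (norm_nonneg _)
        (norm_opC_le β fun q hq => hinitV _ (by omega)) 2
    rw [mul_pow] at h3
    rw [hsqM] at h1 h2 h3
    have hX : 0 ≤ M₀ * Δt ^ (2 * k) := by positivity
    have h4 : Δt * QB e (k - 1) ≤ KB * (M₀ * Δt ^ (2 * k)) :=
      (mul_le_of_le_one_left (hB2 e (k - 1)) hΔ1).trans h2
    have h5 : Δt * ‖opC k β e (k - 1)‖ ^ 2 ≤ cC ^ 2 * (M₀ * Δt ^ (2 * k)) :=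
      (mul_le_of_le_one_left (sq_nonneg _) hΔ1).trans h3
    have h6 := mul_le_mul_of_nonneg_left h5 (by positivity : 0 ≤ g / 2 + ρ / 2)
    simp only [hS, Finset.Icc_self, Finset.sum_singleton, hs]
    linarith
  have hFD : Real.exp (a * T) * (s * Δt ^ (2 * k) + b * Δt ^ (2 * k) * T)
      = F * Δt ^ (2 * k) := by rw [hF]; ring
  have hbound : ∀ n : ℕ, k - 1 ≤ n → n * Δt ≤ T → S n ≤ F * Δt ^ (2 * k) := by
    intro n hn hnT
    rw [← hFD]
    refine discrete_gronwall_of_bound ha0 (by positivity) (by positivity) hΔ.le hS0 ?_ n hn hnT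
    intro n hn hnT hSn
    rw [hFD] at hSn
    have hkn : k ≤ n + 1 := by omega
    have hnT' : (n : ℝ) * Δt ≤ T := by linarith
    obtain ⟨hE, hR, hP⟩ := hTE Δt hΔ (hΔτ.trans h2τ) n hkn hnT
    have hc := hclose n hkn hnT' hSn
    have ht := htime n hnT'
    have hv : ‖u ((n + β) * Δt) - u (n * Δt)‖ ≤ 1 / 4 := by
      refine (hunif _ ⟨ht.1.le, ht.2.le⟩ _ ⟨by positivity, by linarith⟩ ?_).trans hε
      rw [← sub_mul, add_sub_cancel_left, abs_of_pos (by positivity)]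
      exact le_trans (mul_le_mul_of_nonneg_right (by simp) hΔ.le) hδΔ
    -- The distances `1/2` from `C_k^β(φ^n)` to `u(t^{n+β})` and `1/4` from there to `u(t^n)` add up
    -- to less than `1`.
    have hmem' : u ((n + β) * Δt) ∈ Metric.closedBall (u (n * Δt)) 1 := by
      rw [mem_closedBall_iff_norm]; linarith
    have hmem : opC k β φ n ∈ Metric.closedBall (u (n * Δt)) 1 := by
      rw [mem_closedBall_iff_norm]
      have := norm_add_le (opC k β φ n - u ((n + β) * Δt)) (u ((n + β) * Δt) - u (n * Δt))
      rw [sub_add_sub_cancel] at this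
      linarith
    have hen := hφ.energy_le hL hu hγ hG hΔ hkn hnT ht hK.le hE hR hP hmem hmem'
    have hA := hA1 (fun j => ι (e j)) n hkn
    have hB := mul_le_mul_of_nonneg_left (hB1 e n hkn) hΔ.le
    have hst := energy_step (qA := QA (fun j => ι (e j)) n) (qA' := QA (fun j => ι (e j)) (n + 1))
      (qB := QB e n) (qB' := QB e (n + 1)) (x := ‖opC k β e n‖) (x' := ‖opC k β e (n + 1)‖)
      (z := ‖opC k β (fun j => ι (e j)) n‖) (m := m) (d := K₁ * Δt ^ k) (η := eta k β)
      hΔ.le hρ hg0 (by linarith) (by linarith)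
    have hz := (hA2 (fun j => ι (e j)) n hkn).2
    -- The right-hand side involves only the old energy, so the recursion is explicit and Gronwall
    -- needs no smallness of `a Δt`.
    have h1 : Δt / ρ * (m ^ 2 * ‖opC k β (fun j => ι (e j)) n‖ ^ 2 + (K₁ * Δt ^ k) ^ 2)
        ≤ a * Δt * S n + b * Δt ^ (2 * k) * Δt := by
      have h2 : cA * ‖opC k β (fun j => ι (e j)) n‖ ^ 2 ≤ S n := by
        have : 0 ≤ ρ / 2 * Δt * ∑ q ∈ Finset.Icc (k - 1) n, ‖opC k β e q‖ ^ 2 :=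
          mul_nonneg (by positivity) (hsum0 n)
        linarith [hQS n]
      have h3 := mul_le_mul_of_nonneg_left h2 (by positivity : 0 ≤ a * Δt)
      have h4 : a * Δt * (cA * ‖opC k β (fun j => ι (e j)) n‖ ^ 2)
          = Δt / ρ * (m ^ 2 * ‖opC k β (fun j => ι (e j)) n‖ ^ 2) := by
        rw [ha]; field_simp
      have h5 : Δt / ρ * (K₁ * Δt ^ k) ^ 2 = b * Δt ^ (2 * k) * Δt := by
        rw [hb, mul_pow, ← pow_mul, mul_comm k]; ring
      rw [mul_add, h5, ← h4]
      linarith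
    have h2 : S (n + 1) = QA (fun j => ι (e j)) (n + 1) + Δt * QB e (n + 1)
        + Δt * (g / 2) * ‖opC k β e (n + 1)‖ ^ 2 + ρ / 2 * Δt * ‖opC k β e (n + 1)‖ ^ 2
        + ρ / 2 * Δt * ∑ q ∈ Finset.Icc (k - 1) n, ‖opC k β e q‖ ^ 2 := by
      simp only [hS]
      rw [Finset.sum_Icc_succ_top (by omega)]
      ring
    have h3 : S n = QA (fun j => ι (e j)) n + Δt * QB e n + Δt * (g / 2) * ‖opC k β e n‖ ^ 2
        + ρ / 2 * Δt * ∑ q ∈ Finset.Icc (k - 1) n, ‖opC k β e q‖ ^ 2 := rfl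
    linarith
  have hnT' : ((n + 1 : ℕ) : ℝ) * Δt ≤ T := by push_cast; exact hnT
  by_cases hn : k ≤ n + 2
  · have hSn := hbound (n + 1) (by omega) hnT'
    refine ⟨fun _ => ?_, ?_⟩
    · have := hclose (n + 1) (by omega) hnT' hSn
      push_cast at this
      rw [mem_closedBall_iff_norm]
      linarith
    · have h1 := (hA2 (fun j => ι (e j)) (n + 1) (by omega)).1
      have h2 := hQS (n + 1)
      have h3 := hQA0 (n + 1) (by omega)
      have h4 : 0 ≤ ρ / 2 * Δt * ∑ q ∈ Finset.Icc (k - 1) (n + 1), ‖opC k β e q‖ ^ 2 :=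
        mul_nonneg (by positivity) (hsum0 _)
      have h5 : ‖ι (e (n + 1))‖ ^ 2 ≤ cA⁻¹ * (F * Δt ^ (2 * k)) := by
        rw [← div_eq_inv_mul, le_div_iff₀ hcA]
        linarith
      have h6 : C * Δt ^ (2 * k) = cA⁻¹ * (F * Δt ^ (2 * k)) + F * Δt ^ (2 * k)
          + M₀ * Δt ^ (2 * k) + Δt ^ (2 * k) := by rw [hC]; ring
      have h7 : 0 ≤ M₀ * Δt ^ (2 * k) := by positivity
      rw [h6]
      linarith
  -- Here `n + 1 < k - 1`: a starting value, with an empty sum.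
  · refine ⟨fun h => absurd h hn, ?_⟩
    rw [Finset.Icc_eq_empty (by omega), Finset.sum_empty, mul_zero, add_zero]
    refine (hinit.accurate (n + 1) (by omega) (by omega)).1.trans ?_
    refine mul_le_mul_of_nonneg_right ?_ hD0
    have h1 : C₀ ≤ M₀ := le_max_left _ _
    have h2 : 0 ≤ (cA⁻¹ + 1) * F := by positivity
    linarith

end Convergence

end IMEX

/-! ### The theorem -/

theorem theorem3 :
    ∃ g : ℕ → ℝ, (∀ k, 0 < g k) ∧
      ∀ (V H : Type*) [NormedAddCommGroup V] [InnerProductSpace ℝ V] [CompleteSpace V]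
        [NormedAddCommGroup H] [InnerProductSpace ℝ H] [CompleteSpace H]
        (ι : V →L[ℝ] H) (_ : Function.Injective ι) (_ : DenseRange ι)
        (L : V →ₗ[ℝ] StrongDual ℝ V) (_ : ∀ v w : V, L v w = L w v) (_ : ∀ v : V, L v v = ‖v‖ ^ 2)
        (G : V → StrongDual ℝ V) (f : ℝ → StrongDual ℝ V)
        (T T' : ℝ) (_ : 0 < T) (_ : T < T')
        (u : ℝ → V) (_ : IMEX.IsSolution ι L G f T' u)
        (γ μ : ℝ) (_ : 0 ≤ γ) (_ : IMEX.LocalLipschitz ι G T u γ μ)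
        (k : ℕ) (β : ℝ) (_ : ((k = 2 ∨ k = 3) ∧ 1 < β) ∨ (k = 4 ∧ 2 ≤ β))
        (ρ : ℝ) (_ : 0 < ρ) (_ : ρ ≤ IMEX.eta k β - √γ),
        -- smooth solutions have truncation errors of optimal order
        (ContDiffOn ℝ k u (Set.Icc 0 T') →
          ContDiffOn ℝ (k + 1) (fun s => ι (u s)) (Set.Icc 0 T') →
          IMEX.TruncationErrorBound ι u T k β) ∧
        -- truncation errors of optimal order imply the error estimate
        (IMEX.TruncationErrorBound ι u T k β →
          ∀ C₀ : ℝ, ∃ C > 0, ∃ τ > 0, C * τ < 1 ∧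
            ∀ Δt : ℝ, 0 < Δt → Δt ≤ τ → ∀ φ : ℕ → V,
              IMEX.InitialSteps ι u k β Δt C₀ φ →
              IMEX.SolvesScheme ι L G f T k β Δt φ →
              ∀ n : ℕ, (n + 1) * Δt ≤ T →
                (k ≤ n + 2 →
                  IMEX.opC k β φ (n + 1) ∈ Metric.closedBall (u ((n + 1 + β) * Δt)) 1) ∧
                g k * ‖ι (φ (n + 1) - u (((n + 1 : ℕ) : ℝ) * Δt))‖ ^ 2
                  + ρ / 2 * Δt * ∑ q ∈ Finset.Icc (k - 1) (n + 1),
                      ‖IMEX.opC k β (fun j : ℕ => φ j - u (j * Δt)) q‖ ^ 2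
                  ≤ C * Real.exp ((1 - C * Δt)⁻¹ * T) * Δt ^ (2 * k)) := by
  -- `g_k = 1` suffices, because the coercivity constant of the energy is absorbed in `C`. The
  -- exponential factor in the statement is at least `1`, as `C Δt < 1`; Gronwall's own exponential
  -- is already part of `C`.
  refine ⟨fun _ => 1, fun _ => one_pos, ?_⟩
  intro V H _ _ _ _ _ _ ι _ _ L hsymm hnorm G f T T' hT hTT' u hu γ μ hγ hG k β hkβ ρ hρ hη
  have hk : k = 2 ∨ k = 3 ∨ k = 4 := by omega
  have hβ : 1 ≤ β := by rcases hkβ with h | h <;> linarith [h.2]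
  refine ⟨IMEX.truncationErrorBound_of_contDiffOn ι hT hTT' hk hβ, fun hTE C₀ => ?_⟩
  obtain ⟨C, hC, τ, hτ, hCτ, h⟩ := IMEX.error_estimate
    (IMEX.apply_apply_eq_inner hsymm hnorm) hT hTT' hu hγ hG hkβ hρ hη hTE C₀
  refine ⟨C, hC, τ, hτ, hCτ, fun Δt hΔ hΔτ φ hinit hφ n hn => ?_⟩
  obtain ⟨hmem, hest⟩ := h Δt hΔ hΔτ φ hinit hφ n hn
  refine ⟨hmem, ?_⟩
  rw [one_mul]
  have hCΔ : C * Δt < 1 := (mul_le_mul_of_nonneg_left hΔτ hC.le).trans_lt hCτ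
  have hexp : 1 ≤ Real.exp ((1 - C * Δt)⁻¹ * T) :=
    Real.one_le_exp (mul_nonneg (inv_nonneg.2 (by linarith)) hT.le)
  refine hest.trans (mul_le_mul_of_nonneg_right ?_ (by positivity))
  exact le_mul_of_one_le_right hC.le hexp
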